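/- **Filters and the topos $\mathcal{U}$.** A *filter* $F=(C,(F_i)_{i\in I})$ is a set $C$ with a family of subsets $F_i\subseteq C$ (*base sets*) indexed by a nonempty set $I$, such that for all $i,j$ there is $k$ with $F_k\subseteq F_i\cap F_j$; base sets may be empty. A *continuous partial map* $(C,(F_i)_I)\to(D,(G_j)_J)$ is a function $\alpha$ from some base set $F_i$ to $D$ such that for every $j$ some $F_{i'}\subseteq F_i$ is mapped into $G_j$; two such maps are identified if they agree on a base set contained in both domains. The resulting classes (germs) are the morphisms of the category $\mathfrak{F}\mathbf{Set}$. A set $A$ is regarded as the filter $(A,\{A\})$. For a filter $F$ and $x\in A$, $x!:F\to A$ is the germ of the constant map with value $x$. A morphism $\beta$ from $(C,(F_i)_I)$ to $(D,(G_j)_J)$ is *covering* if for every base set $F_i$ (contained in the domain of $\beta$) there is $j$ with $G_j\subseteq\beta(F_i)$. Let $K_1$ be the Grothendieck topology on $\mathfrak{F}\mathbf{Set}$ whose covers are the single covering morphisms $G\to F$ (the empty family is not a cover, even of an improper filter). $K_1$ is subcanonical; let $\mathcal{U}=\mathrm{Sh}(\mathfrak{F}\mathbf{Set},K_1)$ and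 let $\mathbf{y}$ be the Yoneda embedding. **Language and interpretation.** Let $\mathcal{L}$ be a many-sorted first-order language interpreted in $\mathbf{Set}$: types $S$ denote sets (possibly empty), function symbols denote functions, relation symbols denote relations. The types are closed under $S\mapsto S^*$, the type of finite sequences of elements of $S$. Atomic formulas are $R(\vec t)$, $s=_S t$, $t\in s$ (for $t:S$, $s:S^*$; it says that $t$ is an entry of $s$), and absurdity $\bot$ (the empty relation; $\neg\Phi$ is $\Phi\to\bot$). Let $\mathcal{L}_{\mathrm{st}}$ be $\mathcal{L}$ with a new predicate $\mathrm{st}_S$ on each type $S$. In $\mathcal{U}$, the type $S$ is interpreted as $\mathbf{y}S$, function and relation symbols as the images under $\mathbf{y}$ of their interpretations in $\mathbf{Set}$ (so $\bot$ as $\mathbf{y}\emptyset$), and $\mathrm{st}_S$ as the subobject $\Delta_1S\hookrightarrow\mathbf{y}S$ whose sections over $F$ are the germs $x!:F\to S$, $x\in S$. The connectives $\wedge,\vee,\to$ and the quantifiers are interpreted by the corresponding operations on subobjects in $\mathcal{U}$ (Kripke–Joyal semantics). A formula $\Phi$ with free variables among $x_1:S_1,\dots,x_n:S_n$ *holds in*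 $\mathcal{U}$ if it denotes all of $\mathbf{y}(S_1\times\dots\times S_n)$, i.e. if it is forced at every filter for all values of its free variables. A formula is *internal* if it does not contain $\mathrm{st}$, and *$\vee$-free* if it does not contain $\vee$. Write $\forall^{\mathrm{st}}x\,\Phi$ for $\forall x(\mathrm{st}(x)\to\Phi)$ and $\exists^{\mathrm{st}}x\,\Phi$ for $\exists x(\mathrm{st}(x)\wedge\Phi)$. For $s:S^*$ let $\mathrm{hyper}(s)$ be $\forall^{\mathrm{st}}x:S\,(x\in s)$, and write $\forall^{\mathrm{hyp}}s\,\Phi$ for $\forall s(\mathrm{hyper}(s)\to\Phi)$ and $\exists^{\mathrm{hyp}}s\,\Phi$ for $\exists s(\mathrm{hyper}(s)\wedge\Phi)$. **Proposition.** For all types $S,T$ of $\mathcal{L}$, all internal $\vee$-free formulas $\varphi$ and all formulas $\Phi,\Psi$ of $\mathcal{L}_{\mathrm{st}}$, possibly with further free variables as parameters, the following hold in $\mathcal{U}$: - $\mathsf{OS}^*_\vee$: $\ \forall^{\mathrm{st}}s:S^*\,\varphi(s)\ \to\ \exists^{\mathrm{hyp}}s:S^*\,\varphi(s)$; - $\mathsf{US}^*_\vee$: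 $\ \forall^{\mathrm{hyp}}s:S^*\,\varphi(s)\ \to\ \exists^{\mathrm{st}}s:S^*\,\varphi(s)$; - $\mathsf{IP}^{\mathrm{st}}_{\forall\vee}$: $\ \bigl(\forall^{\mathrm{st}}x:S\,\varphi(x)\to\exists^{\mathrm{st}}y:T\,\Psi(y)\bigr)\ \to\ \exists^{\mathrm{st}}y:T\,\bigl(\forall^{\mathrm{st}}x:S\,\varphi(x)\to\Psi(y)\bigr)$, where in both places the premise is the formula $\forall^{\mathrm{st}}x\,\varphi(x)$; - $\mathsf{NU}$: $\ \forall y:T\,\exists^{\mathrm{st}}x:S\,\Phi(x,y)\ \to\ \exists^{\mathrm{st}}x:S\,\forall y:T\,\Phi(x,y)$; - $\mathsf{AC}^{\mathrm{st}}$ (using the axiom of choice in the metatheory): $\ \forall^{\mathrm{st}}x:S\,\exists^{\mathrm{st}}y:T\,\Phi(x,y)\ \to\ \exists^{\mathrm{st}}f:S\to T\ \forall^{\mathrm{st}}x:S\,\Phi(x,f(x))$, whenever $\mathcal{L}$ has a type $S\to T$ denoting the set of all functions from $S$ to $T$, with a symbol for application. -/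

import Mathlib

open CategoryTheory Opposite

universe u v w

/-! ## The category of filters `𝔉Set` -/

/-- A filter `(C, 𝓕_I)`: a set `C` with an inhabited family `(𝓕_i)_{i ∈ I}` of subsets of `C`
such that every intersection `𝓕_i ∩ 𝓕_j` contains some `𝓕_k`. The improper filters, those with
an empty base set, are included. -/
structure FiltObj : Type (u + 1) where
  carrier : Type u
  Idx : Type u
  base : Idx → Set carrier
  inhabited : Nonempty Idx
  directed : ∀ i j, ∃ k, base k ⊆ base i ∩ base j

namespace FiltObj

/-- A continuous partial map `(C, 𝓕_I) → (D, 𝓖_J)`: a function on some base set `𝓕_i` such that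
for every `j` some `𝓕_{i'}` is contained in (the domain `𝓕_i` and) the preimage of `𝓖_j`. -/
structure PartialMap (F G : FiltObj.{u}) where
  idx : F.Idx
  toFun : F.base idx → G.carrier
  cont : ∀ j, ∃ i, ∀ a ∈ F.base i, ∃ h : a ∈ F.base idx, toFun ⟨a, h⟩ ∈ G.base j

/-- Two continuous partial maps are equivalent if some base set is contained in both domains and
they agree on it. -/
def PartialMap.Equivalent {F G : FiltObj.{u}} (f g : PartialMap F G) : Prop :=
  ∃ k, ∀ a ∈ F.base k, ∃ (hf : a ∈ F.base f.idx) (hg : a ∈ F.base g.idx),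
    f.toFun ⟨a, hf⟩ = g.toFun ⟨a, hg⟩

instance germSetoid (F G : FiltObj.{u}) : Setoid (PartialMap F G) where
  r := PartialMap.Equivalent
  iseqv :=
    { refl := fun f => ⟨f.idx, fun _ h => ⟨h, h, rfl⟩⟩
      symm := by
        rintro f g ⟨k, h⟩
        refine ⟨k, fun a ha => ?_⟩
        obtain ⟨h1, h2, h3⟩ := h a ha
        exact ⟨h2, h1, h3.symm⟩
      trans := by
        rintro f g e ⟨k, h⟩ ⟨l, h'⟩
        obtain ⟨m, hm⟩ := F.directed k l
        refine ⟨m, fun a ha => ?_⟩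
        obtain ⟨h1, h2, h3⟩ := h a (hm ha).1
        obtain ⟨h4, h5, h6⟩ := h' a (hm ha).2
        exact ⟨h1, h5, h3.trans h6⟩ }

/-- A total function that is continuous, as a partial map (restricted to some base set). -/
noncomputable def PartialMap.ofTotal {F G : FiltObj.{u}} (f : F.carrier → G.carrier)
    (hf : ∀ j, ∃ i, ∀ a ∈ F.base i, f a ∈ G.base j) : PartialMap F G where
  idx := Classical.choice F.inhabited
  toFun a := f a
  cont j := by
    obtain ⟨i, hi⟩ := hf j
    obtain ⟨k, hk⟩ := F.directed i (Classical.choice F.inhabited)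
    exact ⟨k, fun a ha => ⟨(hk ha).2, hi a (hk ha).1⟩⟩

/-- Composition of partial maps, on some base set on which the composite is defined. -/
noncomputable def PartialMap.comp {F G H : FiltObj.{u}} (f : PartialMap F G)
    (g : PartialMap G H) : PartialMap F H where
  idx := (f.cont g.idx).choose
  toFun a := g.toFun ⟨f.toFun ⟨a, ((f.cont g.idx).choose_spec a a.2).choose⟩,
    ((f.cont g.idx).choose_spec a a.2).choose_spec⟩
  cont j := by
    obtain ⟨i, hi⟩ := g.cont j
    obtain ⟨k, hk⟩ := f.cont i
    obtain ⟨l, hl⟩ := F.directed k (f.cont g.idx).choose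
    refine ⟨l, fun a ha => ⟨(hl ha).2, ?_⟩⟩
    obtain ⟨h1, h2⟩ := hk a (hl ha).1
    obtain ⟨h3, h4⟩ := hi _ h2
    exact h4

theorem PartialMap.comp_toFun {F G H : FiltObj.{u}} (f : PartialMap F G) (g : PartialMap G H)
    (a : F.carrier) (ha : a ∈ F.base (f.comp g).idx) :
    ∃ (h : a ∈ F.base f.idx) (h' : f.toFun ⟨a, h⟩ ∈ G.base g.idx),
      (f.comp g).toFun ⟨a, ha⟩ = g.toFun ⟨f.toFun ⟨a, h⟩, h'⟩ :=
  ⟨_, _, rfl⟩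

theorem PartialMap.comp_equivalent {F G H : FiltObj.{u}} {f f' : PartialMap F G}
    {g g' : PartialMap G H} (hf : f.Equivalent f') (hg : g.Equivalent g') :
    (f.comp g).Equivalent (f'.comp g') := by
  obtain ⟨k, hk⟩ := hf
  obtain ⟨l, hl⟩ := hg
  obtain ⟨m, hm⟩ := f.cont l
  obtain ⟨n, hn⟩ := F.directed k m
  obtain ⟨p, hp⟩ := F.directed (f.comp g).idx (f'.comp g').idx
  obtain ⟨q, hq⟩ := F.directed n p
  refine ⟨q, fun a ha => ⟨(hp (hq ha).2).1, (hp (hq ha).2).2, ?_⟩⟩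
  obtain ⟨h1, h2, h3⟩ := PartialMap.comp_toFun f g a (hp (hq ha).2).1
  obtain ⟨h1', h2', h3'⟩ := PartialMap.comp_toFun f' g' a (hp (hq ha).2).2
  obtain ⟨_, _, e⟩ := hk a (hn (hq ha).1).1
  obtain ⟨_, e'⟩ := hm a (hn (hq ha).1).2
  obtain ⟨_, _, e''⟩ := hl _ e'
  rw [h3, h3', e'']
  congr 2

/-- The filter category `𝔉Set`: morphisms are germs of continuous partial maps. -/
noncomputable instance : LargeCategory.{u} FiltObj.{u} where
  Hom F G := Quotient (germSetoid F G)
  id F := Quotient.mk _ (PartialMap.ofTotal id fun j => ⟨j, fun _ h => h⟩)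
  comp f g := Quotient.map₂ PartialMap.comp
    (fun _ _ h _ _ h' => PartialMap.comp_equivalent h h') f g
  id_comp f := by
    induction f using Quotient.inductionOn with | _ f
    refine Quotient.sound ?_
    obtain ⟨k, hk⟩ := FiltObj.directed _ f.idx (PartialMap.comp (PartialMap.ofTotal id
      fun j => ⟨j, fun _ h => h⟩) f).idx
    exact ⟨k, fun a ha => ⟨(hk ha).2, (hk ha).1, rfl⟩⟩
  comp_id f := by
    induction f using Quotient.inductionOn with | _ f
    refine Quotient.sound ?_
    obtain ⟨k, hk⟩ := FiltObj.directed _ f.idx (PartialMap.comp f (PartialMap.ofTotal id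
      fun j => ⟨j, fun _ h => h⟩)).idx
    exact ⟨k, fun a ha => ⟨(hk ha).2, (hk ha).1, rfl⟩⟩
  assoc f g h := by
    induction f using Quotient.inductionOn with | _ f
    induction g using Quotient.inductionOn with | _ g
    induction h using Quotient.inductionOn with | _ h
    refine Quotient.sound ?_
    obtain ⟨k, hk⟩ := FiltObj.directed _ ((f.comp g).comp h).idx (f.comp (g.comp h)).idx
    exact ⟨k, fun a ha => ⟨(hk ha).1, (hk ha).2, rfl⟩⟩

/-- The germ of a continuous partial map, as a morphism of `𝔉Set`. -/
def germ {F G : FiltObj.{u}} (f : PartialMap F G) : F ⟶ G := Quotient.mk _ f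

theorem germ_comp {F G H : FiltObj.{u}} (f : PartialMap F G) (g : PartialMap G H) :
    germ f ≫ germ g = germ (f.comp g) := rfl

theorem germ_eq_iff {F G : FiltObj.{u}} (f g : PartialMap F G) :
    germ f = germ g ↔ f.Equivalent g :=
  ⟨fun h => Quotient.exact h, fun h => Quotient.sound h⟩

theorem exists_germ {F G : FiltObj.{u}} (f : F ⟶ G) : ∃ p, germ p = f :=
  Quotient.exists_rep f

/-- The simple filter `(A, {A})`, by which a set `A` is regarded as an object of `𝔉Set`. -/
def simple (A : Type u) : FiltObj.{u} where
  carrier := A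
  Idx := PUnit
  base _ := Set.univ
  inhabited := ⟨⟨⟩⟩
  directed _ _ := ⟨⟨⟩, by simp⟩

/-- The germ `F ⟶ A` of a total function into a set `A`. -/
noncomputable def ofFun (F : FiltObj.{u}) {A : Type u} (f : F.carrier → A) : F ⟶ simple A :=
  germ (PartialMap.ofTotal (G := simple A) f
    fun _ => ⟨Classical.choice F.inhabited, fun _ _ => trivial⟩)

/-- The functor `Set ⥤ 𝔉Set` on morphisms. -/
noncomputable def simpleMap {A B : Type u} (f : A → B) : simple A ⟶ simple B :=
  ofFun (simple A) f

/-- The constant germ `x! : F ⟶ A` with value `x ∈ A`. -/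
noncomputable def const (F : FiltObj.{u}) {A : Type u} (x : A) : F ⟶ simple A :=
  ofFun F fun _ => x

/-! ## The topology `K₁` of single covers and the topos `𝒰` -/

/-- A partial map is covering if its image is the whole of the target: for every base set `𝓕_i`
of the source, some base set of the target is contained in the image of `𝓕_i`. -/
def PartialMap.Covering {F G : FiltObj.{u}} (f : PartialMap F G) : Prop :=
  ∀ i, ∃ j, ∀ b ∈ G.base j, ∃ a ∈ F.base i, ∃ h : a ∈ F.base f.idx, f.toFun ⟨a, h⟩ = b

theorem PartialMap.Covering.of_equivalent {F G : FiltObj.{u}} {f g : PartialMap F G}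
    (h : f.Equivalent g) (hf : f.Covering) : g.Covering := by
  intro i
  obtain ⟨k, hk⟩ := h
  obtain ⟨l, hl⟩ := F.directed i k
  obtain ⟨j, hj⟩ := hf l
  refine ⟨j, fun b hb => ?_⟩
  obtain ⟨a, ha, _, e⟩ := hj b hb
  obtain ⟨_, h2, e2⟩ := hk a (hl ha).2
  exact ⟨a, (hl ha).1, h2, e2.symm.trans e⟩

/-- Covering morphisms `f : F ↠ G` of `𝔉Set`. -/
def Covering {F G : FiltObj.{u}} (f : F ⟶ G) : Prop :=
  Quotient.liftOn f PartialMap.Covering fun _ _ h =>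
    propext ⟨.of_equivalent h, .of_equivalent (Setoid.symm h)⟩

theorem covering_germ {F G : FiltObj.{u}} (f : PartialMap F G) :
    Covering (germ f) ↔ f.Covering := Iff.rfl

theorem covering_id (F : FiltObj.{u}) : Covering (𝟙 F) := by
  intro i
  obtain ⟨k, hk⟩ := F.directed i (Classical.choice F.inhabited)
  exact ⟨k, fun b hb => ⟨b, (hk hb).1, (hk hb).2, rfl⟩⟩

theorem Covering.comp {F G H : FiltObj.{u}} {f : F ⟶ G} {g : G ⟶ H} (hf : Covering f)
    (hg : Covering g) : Covering (f ≫ g) := by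
  obtain ⟨f, rfl⟩ := exists_germ f
  obtain ⟨g, rfl⟩ := exists_germ g
  rw [germ_comp]
  rw [covering_germ] at *
  intro i
  obtain ⟨i', hi'⟩ := F.directed i (f.comp g).idx
  obtain ⟨j, hj⟩ := hf i'
  obtain ⟨k, hk⟩ := hg j
  refine ⟨k, fun c hc => ?_⟩
  obtain ⟨b, hb, hb', e⟩ := hk c hc
  obtain ⟨a, ha, ha', e'⟩ := hj b hb
  refine ⟨a, (hi' ha).1, (hi' ha).2, ?_⟩
  obtain ⟨h1, h2, h3⟩ := PartialMap.comp_toFun f g a (hi' ha).2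
  rw [h3, ← e]
  congr 2

/-- Covering morphisms have covering pullbacks. -/
theorem exists_square {F G H : FiltObj.{u}} (f : PartialMap G F) (g : PartialMap H F) :
    ∃ (P : FiltObj.{u}) (p : PartialMap P G) (q : PartialMap P H),
      (germ p ≫ germ f = germ q ≫ germ g) ∧ (f.Covering → q.Covering) ∧
      (∀ i, ∃ j k, ∀ a ∈ G.base j, ∀ b ∈ H.base k, ∀ (ha : a ∈ G.base f.idx)
        (hb : b ∈ H.base g.idx), f.toFun ⟨a, ha⟩ = g.toFun ⟨b, hb⟩ →
        ∃ x ∈ P.base i, (∀ h : x ∈ P.base p.idx, p.toFun ⟨x, h⟩ = a) ∧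
          ∀ h : x ∈ P.base q.idx, q.toFun ⟨x, h⟩ = b) := by
  let P : FiltObj.{u} :=
    { carrier := G.carrier × H.carrier
      Idx := G.Idx × H.Idx
      base := fun i => {x | x.1 ∈ G.base i.1 ∧ x.2 ∈ H.base i.2 ∧
        ∃ (h : x.1 ∈ G.base f.idx) (h' : x.2 ∈ H.base g.idx),
          f.toFun ⟨x.1, h⟩ = g.toFun ⟨x.2, h'⟩}
      inhabited := ⟨(f.idx, g.idx)⟩
      directed := by
        rintro ⟨i, j⟩ ⟨i', j'⟩
        obtain ⟨k, hk⟩ := G.directed i i'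
        obtain ⟨l, hl⟩ := H.directed j j'
        exact ⟨(k, l), fun x hx => ⟨⟨(hk hx.1).1, (hl hx.2.1).1, hx.2.2⟩,
          (hk hx.1).2, (hl hx.2.1).2, hx.2.2⟩⟩ }
  refine ⟨P, PartialMap.ofTotal (F := P) Prod.fst fun j => ⟨(j, g.idx), fun a ha => ha.1⟩,
    PartialMap.ofTotal (F := P) Prod.snd fun j => ⟨(f.idx, j), fun a ha => ha.2.1⟩, ?_, ?_, ?_⟩
  · rw [germ_comp, germ_comp, germ_eq_iff]
    obtain ⟨k, hk⟩ := P.directed (PartialMap.comp (PartialMap.ofTotal (F := P) Prod.fst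
      fun j => ⟨(j, g.idx), fun a ha => ha.1⟩) f).idx (PartialMap.comp (PartialMap.ofTotal
      (F := P) Prod.snd fun j => ⟨(f.idx, j), fun a ha => ha.2.1⟩) g).idx
    refine ⟨k, fun a ha => ⟨(hk ha).1, (hk ha).2, ?_⟩⟩
    exact (hk ha).1.2.2.choose_spec.choose_spec
  · intro hf i
    obtain ⟨⟨j, k⟩, hi⟩ := P.directed i (Classical.choice P.inhabited)
    obtain ⟨l, hl⟩ := hf j
    obtain ⟨m, hm⟩ := g.cont l
    obtain ⟨n, hn⟩ := H.directed k m
    refine ⟨n, fun b hb => ?_⟩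
    obtain ⟨hb', e⟩ := hm b (hn hb).2
    obtain ⟨a, ha, ha', e'⟩ := hl _ e
    have hx : ((a, b) : G.carrier × H.carrier) ∈ P.base (j, k) :=
      ⟨ha, (hn hb).1, ha', hb', e'⟩
    exact ⟨(a, b), (hi hx).1, (hi hx).2, rfl⟩
  · rintro ⟨j, k⟩
    exact ⟨j, k, fun a ha b hb ha' hb' e => ⟨(a, b), ⟨ha, hb, ha', hb', e⟩, fun _ => rfl,
      fun _ => rfl⟩⟩

/-- Covering morphisms are epimorphisms. -/
theorem Covering.cancel {F G H : FiltObj.{u}} {f : F ⟶ G} (hf : Covering f) {g h : G ⟶ H}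
    (e : f ≫ g = f ≫ h) : g = h := by
  obtain ⟨f, rfl⟩ := exists_germ f
  obtain ⟨g, rfl⟩ := exists_germ g
  obtain ⟨h, rfl⟩ := exists_germ h
  rw [germ_comp, germ_comp, germ_eq_iff] at e
  rw [germ_eq_iff]
  obtain ⟨k, hk⟩ := e
  obtain ⟨j, hj⟩ := hf k
  refine ⟨j, fun b hb => ?_⟩
  obtain ⟨a, ha, ha', rfl⟩ := hj b hb
  obtain ⟨h1, h2, h3⟩ := hk a ha
  obtain ⟨_, h4, h5⟩ := PartialMap.comp_toFun f g a h1
  obtain ⟨_, h4', h5'⟩ := PartialMap.comp_toFun f h a h2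
  exact ⟨h4, h4', h5.symm.trans (h3.trans h5')⟩

/-- The topology `K₁` on `𝔉Set`, where a cover of `F` is a single covering morphism `G ↠ F`. -/
def K₁ : GrothendieckTopology FiltObj.{u} where
  sieves F := {S | ∃ (G : FiltObj.{u}) (f : G ⟶ F), S f ∧ Covering f}
  top_mem' F := ⟨F, 𝟙 F, trivial, covering_id F⟩
  pullback_stable' := by
    rintro F H S g ⟨G, f, hS, hf⟩
    obtain ⟨f, rfl⟩ := exists_germ f
    obtain ⟨g, rfl⟩ := exists_germ g
    obtain ⟨P, p, q, e, hq, -⟩ := exists_square f g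
    refine ⟨P, germ q, ?_, hq hf⟩
    change S (germ q ≫ germ g)
    rw [← e]
    exact S.downward_closed hS _
  transitive' := by
    rintro F S ⟨G, f, hS, hf⟩ R hR
    obtain ⟨H, g, hg, hg'⟩ := hR hS
    exact ⟨H, g ≫ f, hg, hg'.comp hf⟩

theorem mem_K₁ {F : FiltObj.{u}} (S : Sieve F) :
    S ∈ K₁ F ↔ ∃ (G : FiltObj.{u}) (f : G ⟶ F), S f ∧ Covering f := Iff.rfl

/-- A germ on the source of a covering morphism which is compatible descends to the target. -/
theorem Covering.descend {F G H : FiltObj.{u}} {f : G ⟶ F} (hf : Covering f) (x : G ⟶ H)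
    (hx : ∀ (P : FiltObj.{u}) (p q : P ⟶ G), p ≫ f = q ≫ f → p ≫ x = q ≫ x) :
    ∃ t : F ⟶ H, f ≫ t = x := by
  obtain ⟨f, rfl⟩ := exists_germ f
  obtain ⟨x, rfl⟩ := exists_germ x
  obtain ⟨P, p, q, e, -, hP⟩ := exists_square f f
  have e' := hx _ _ _ e
  rw [germ_comp, germ_comp, germ_eq_iff] at e'
  obtain ⟨i, hi⟩ := e'
  obtain ⟨j, k, hjk⟩ := hP i
  obtain ⟨l, hl⟩ := G.directed j k
  obtain ⟨m, hm⟩ := G.directed l x.idx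
  have key : ∀ a ∈ G.base m, ∀ b ∈ G.base m, ∀ (ha : a ∈ G.base f.idx) (hb : b ∈ G.base f.idx)
      (ha' : a ∈ G.base x.idx) (hb' : b ∈ G.base x.idx),
      f.toFun ⟨a, ha⟩ = f.toFun ⟨b, hb⟩ → x.toFun ⟨a, ha'⟩ = x.toFun ⟨b, hb'⟩ := by
    intro a ha b hb h1 h2 h3 h4 h5
    obtain ⟨y, hy, hp, hq⟩ := hjk a (hl (hm ha).1).1 b (hl (hm hb).1).2 h1 h2 h5
    obtain ⟨g1, g2, g3⟩ := hi y hy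
    obtain ⟨c1, c2, c3⟩ := PartialMap.comp_toFun p x y g1
    obtain ⟨d1, d2, d3⟩ := PartialMap.comp_toFun q x y g2
    have := c3.symm.trans (g3.trans d3)
    simp only [hp c1, hq d1] at this
    exact this
  obtain ⟨n, hn⟩ := hf m
  choose s hs hs' hs'' using hn
  have hcont : ∀ r, ∃ i, ∀ b ∈ F.base i, ∃ h : b ∈ F.base n,
      x.toFun ⟨s b h, (hm (hs b h)).2⟩ ∈ H.base r := by
    intro r
    obtain ⟨c, hc⟩ := x.cont r
    obtain ⟨d, hd⟩ := G.directed c m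
    obtain ⟨o, ho⟩ := hf d
    obtain ⟨o', ho'⟩ := F.directed o n
    refine ⟨o', fun b hb => ⟨(ho' hb).2, ?_⟩⟩
    obtain ⟨a, ha, ha', e⟩ := ho b (ho' hb).1
    obtain ⟨h1, h2⟩ := hc a (hd ha).1
    rw [key _ (hs b (ho' hb).2) a (hd ha).2 (hs' _ _) ha' _ h1 ((hs'' _ _).trans e.symm)]
    exact h2
  refine ⟨germ ⟨n, fun b => x.toFun ⟨s b b.2, (hm (hs b b.2)).2⟩, hcont⟩, ?_⟩
  rw [germ_comp, germ_eq_iff]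
  obtain ⟨c, hc⟩ := G.directed (f.comp ⟨n, fun b => x.toFun ⟨s b b.2, (hm (hs b b.2)).2⟩,
    hcont⟩).idx m
  refine ⟨c, fun a ha => ⟨(hc ha).1, (hm (hc ha).2).2, ?_⟩⟩
  obtain ⟨h1, h2, h3⟩ := PartialMap.comp_toFun f _ a (hc ha).1
  rw [h3]
  exact key _ (hs _ _) a (hc ha).2 (hs' _ _) h1 _ _ (hs'' _ _)

instance : (K₁.{u}).Subcanonical := by
  refine GrothendieckTopology.Subcanonical.of_isSheaf_yoneda_obj _ fun H F S hS => ?_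
  obtain ⟨G, f, hf, hc⟩ := hS
  intro x hx
  obtain ⟨t, ht⟩ := hc.descend (x f hf) fun P p q e => hx p q hf hf e
  refine ⟨t, fun G' g hg => ?_, fun t' ht' => hc.cancel ((ht' f hf).trans ht.symm)⟩
  obtain ⟨pf, rfl⟩ := exists_germ f
  obtain ⟨pg, rfl⟩ := exists_germ g
  obtain ⟨P, p, q, e, hq, -⟩ := exists_square pf pg
  have hq' : Covering (germ q) := hq hc
  refine hq'.cancel ?_
  change germ q ≫ germ pg ≫ t = germ q ≫ x (germ pg) hg
  rw [← Category.assoc, ← e, Category.assoc, ht]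
  exact hx (germ p) (germ q) hf hg e

end FiltObj

namespace FiltObj

/-- The topos `𝒰 = Sh(𝔉Set, K₁)`. -/
abbrev 𝒰 : Type (u + 1) := Sheaf K₁.{u} (Type u)

/-- The sheaf `yA` represented by (the simple filter on) a set `A`. -/
noncomputable abbrev y (A : Type u) : 𝒰.{u} := K₁.yoneda.obj (simple A)

/-- The morphism `yf : yA ⟶ yB` represented by a function `f : A → B`. -/
noncomputable abbrev yMap {A B : Type u} (f : A → B) : (y A).obj ⟶ (y B).obj :=
  yoneda.map (simpleMap f)

/-- The subobject `yP ↪ yA` represented by the inclusion of a subset `P ⊆ A`. -/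
noncomputable def ySub {A : Type u} (P : Set A) : Subfunctor (y A).obj :=
  Subfunctor.range (yMap (Subtype.val : P → A))

theorem comp_const {F G : FiltObj.{u}} (f : G ⟶ F) {A : Type u} (x : A) :
    f ≫ const F x = const G x := by
  obtain ⟨g, rfl⟩ := exists_germ f
  refine (germ_eq_iff _ _).2 ?_
  obtain ⟨k, hk⟩ := FiltObj.directed _ (PartialMap.comp g (PartialMap.ofTotal (G := simple A)
    (fun _ => x) fun _ => ⟨Classical.choice F.inhabited, fun _ _ => trivial⟩)).idx
    (Classical.choice G.inhabited)
  exact ⟨k, fun a ha => ⟨(hk ha).1, (hk ha).2, rfl⟩⟩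

/-- The constant object `Δ₁A ↪ yA`: at each filter `F`, the constant germs `F ⟶ A`. -/
noncomputable def Δ₁ (A : Type u) : Subfunctor (y A).obj where
  obj F := {α : unop F ⟶ simple A | ∃ x : A, α = const (unop F) x}
  map := by
    rintro F G f α ⟨x, rfl⟩
    exact ⟨x, comp_const f.unop x⟩

section Subobjects

variable {X Y : FiltObj.{u}ᵒᵖ ⥤ Type u}

/-- Heyting implication of subobjects. -/
def impl (A B : Subfunctor X) : Subfunctor X where
  obj F := {x | ∀ ⦃G : FiltObj.{u}ᵒᵖ⦄ (f : F ⟶ G), X.map f x ∈ A.obj G → X.map f x ∈ B.obj G}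
  map := by
    intro F G f x hx H g
    have := hx (f ≫ g)
    simpa using this

/-- Universal quantification of a subobject along `p`: right adjoint to pullback along `p`. -/
def forallAlong (p : Y ⟶ X) (A : Subfunctor Y) : Subfunctor X where
  obj F := {x | ∀ ⦃G : FiltObj.{u}ᵒᵖ⦄ (f : F ⟶ G) (z : Y.obj G),
    p.app G z = X.map f x → z ∈ A.obj G}
  map := by
    intro F G f x hx H g z hz
    exact hx (f ≫ g) z (by simpa using hz)

theorem le_impl_iff (A B C : Subfunctor X) : C ≤ impl A B ↔ C ⊓ A ≤ B := by
  constructor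
  · rintro h F x ⟨hC, hA⟩
    have := h F hC (𝟙 F)
    simp only [Functor.map_id_apply] at this
    exact this hA
  · intro h F x hC G f hA
    exact h G ⟨C.map f hC, hA⟩

theorem le_forallAlong_iff (p : Y ⟶ X) (A : Subfunctor Y) (C : Subfunctor X) :
    C ≤ forallAlong p A ↔ C.preimage p ≤ A := by
  constructor
  · intro h F z hz
    exact h F hz (𝟙 F) z (by simp)
  · intro h F x hC G f z hz
    refine h G ?_
    change p.app G z ∈ C.obj G
    rw [hz]
    exact C.map f hC

/-- A subobject in presheaves is closed if it is a subobject in `𝒰`, i.e. a subsheaf. -/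
def IsClosed (A : Subfunctor X) : Prop :=
  ∀ ⦃F G : FiltObj.{u}⦄ (f : G ⟶ F), Covering f → ∀ x : X.obj (op F),
    X.map f.op x ∈ A.obj (op G) → x ∈ A.obj (op F)

theorem isClosed_iff_isSheaf (hX : Presieve.IsSheaf K₁ X) (A : Subfunctor X) :
    IsClosed A ↔ Presieve.IsSheaf K₁ A.toFunctor := by
  rw [A.isSheaf_iff hX]
  constructor
  · rintro h F x ⟨G, f, hf, hc⟩
    exact h f hc x hf
  · intro h F G f hc x hx
    exact h (op F) x ⟨G, f, hx, hc⟩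

theorem IsClosed.inf {A B : Subfunctor X} (hA : IsClosed A) (hB : IsClosed B) :
    IsClosed (A ⊓ B) :=
  fun _ _ f hf x hx => ⟨hA f hf x hx.1, hB f hf x hx.2⟩

theorem IsClosed.preimage {A : Subfunctor X} (hA : IsClosed A) (p : Y ⟶ X) :
    IsClosed (A.preimage p) := by
  intro F G f hf x hx
  refine hA f hf _ ?_
  rw [← NatTrans.naturality_apply]
  exact hx

theorem exists_cover_square {F G H : FiltObj.{u}} (f : G ⟶ F) (hf : Covering f) (g : H ⟶ F) :
    ∃ (P : FiltObj.{u}) (p : P ⟶ G) (q : P ⟶ H), p ≫ f = q ≫ g ∧ Covering q := by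
  obtain ⟨f, rfl⟩ := exists_germ f
  obtain ⟨g, rfl⟩ := exists_germ g
  obtain ⟨P, p, q, e, hq, -⟩ := exists_square f g
  exact ⟨P, germ p, germ q, e, hq hf⟩

theorem IsClosed.impl (A : Subfunctor X) {B : Subfunctor X} (hB : IsClosed B) :
    IsClosed (impl A B) := by
  intro F G f hf x hx H g hA
  obtain ⟨P, p, q, e, hq⟩ := exists_cover_square f hf g.unop
  refine hB q hq _ ?_
  have e' : X.map q.op (X.map g x) = X.map p.op (X.map f.op x) := by
    rw [← Functor.map_comp_apply, ← Functor.map_comp_apply]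
    change X.map (q ≫ g.unop).op x = X.map (p ≫ f).op x
    rw [e]
  rw [e']
  refine hx p.op ?_
  rw [← e']
  exact A.map q.op hA

theorem IsClosed.forallAlong (p : Y ⟶ X) {A : Subfunctor Y} (hA : IsClosed A) :
    IsClosed (forallAlong p A) := by
  intro F G f hf x hx H g z hz
  obtain ⟨P, r, q, e, hq⟩ := exists_cover_square f hf g.unop
  refine hA q hq _ (hx r.op _ ?_)
  rw [NatTrans.naturality_apply, hz, ← Functor.map_comp_apply, ← Functor.map_comp_apply]
  change X.map (q ≫ g.unop).op x = X.map (r ≫ f).op x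
  rw [e]

theorem isClosed_Δ₁ (A : Type u) : IsClosed (Δ₁ A) := by
  rintro F G f hf α ⟨x, hx⟩
  refine ⟨x, hf.cancel ?_⟩
  rw [comp_const]
  exact hx

theorem simpleMap_cancel {A B : Type u} {f : A → B} (hf : Function.Injective f) {F : FiltObj.{u}}
    {α β : F ⟶ simple A} (e : α ≫ simpleMap f = β ≫ simpleMap f) : α = β := by
  obtain ⟨α, rfl⟩ := exists_germ α
  obtain ⟨β, rfl⟩ := exists_germ β
  obtain ⟨k, hk⟩ := (germ_eq_iff _ _).1 e
  refine (germ_eq_iff _ _).2 ⟨k, fun a ha => ?_⟩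
  obtain ⟨h1, h2, h3⟩ := hk a ha
  obtain ⟨h4, _, h5⟩ := PartialMap.comp_toFun α _ a h1
  obtain ⟨h6, _, h7⟩ := PartialMap.comp_toFun β _ a h2
  exact ⟨h4, h6, hf (h5.symm.trans (h3.trans h7))⟩

theorem isClosed_ySub {A : Type u} (P : Set A) : IsClosed (ySub P) := by
  rintro F G f hf α ⟨β, hβ⟩
  change β ≫ simpleMap _ = f ≫ α at hβ
  obtain ⟨t, ht⟩ := hf.descend β fun Q p q e => by
    refine simpleMap_cancel (f := (Subtype.val : P → A)) Subtype.val_injective ?_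
    rw [Category.assoc, Category.assoc, hβ, ← Category.assoc, e, Category.assoc]
  refine ⟨t, hf.cancel ?_⟩
  change f ≫ t ≫ simpleMap _ = f ≫ α
  rw [← hβ, ← ht, Category.assoc]

end Subobjects

end FiltObj

/-! ## Languages with an interpretation in sets, and their formulas -/

/-- A many-sorted first-order language with an interpretation in `Set`, whose types are closed
under the formation of the type `seq S = S*` of finite sequences. `Fn l S` are the function symbols
with argument types `l` and value type `S` (constants being the case `l = []`), and `Rel l` the
relation symbols with argument types `l`. -/
structure SetLanguage : Type (max (u + 1) (v + 1) (w + 1)) where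
  Ty : Type v
  El : Ty → Type u
  seq : Ty → Ty
  seqEquiv : ∀ S, El (seq S) ≃ List (El S)
  Fn : List Ty → Ty → Type w
  Rel : List Ty → Type w
  /-- The interpretation of a function symbol, as a function `S₁ × ⋯ × Sₙ → S`. -/
  fnEl : ∀ {l S}, Fn l S → (l.foldr (fun T A => El T × A) PUnit.{u + 1} → El S)
  /-- The interpretation of a relation symbol, as a subset of `S₁ × ⋯ × Sₙ`. -/
  relEl : ∀ {l}, Rel l → Set (l.foldr (fun T A => El T × A) PUnit.{u + 1})

namespace SetLanguage

variable {L : SetLanguage.{u, v, w}}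

/-- The set `S₁ × ⋯ × Sₙ` interpreting a context `x₁ : S₁, …, xₙ : Sₙ`. -/
abbrev Env (L : SetLanguage.{u, v, w}) (Γ : List L.Ty) : Type u :=
  Γ.foldr (fun T A => L.El T × A) PUnit.{u + 1}

/-- The tuple extending `ρ` by `s`. -/
def Env.cons {S : L.Ty} {Γ : List L.Ty} (s : L.El S) (ρ : L.Env Γ) : L.Env (S :: Γ) := (s, ρ)

/-- The projection to the last variable of a context. -/
def Env.head {S : L.Ty} {Γ : List L.Ty} (ρ : L.Env (S :: Γ)) : L.El S := ρ.1

/-- The projection which forgets the last variable of a context. -/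
def Env.tail {S : L.Ty} {Γ : List L.Ty} (ρ : L.Env (S :: Γ)) : L.Env Γ := ρ.2

/-- The variables of type `S` in a context. -/
inductive Var : List L.Ty → L.Ty → Type v
  | zero {Γ : List L.Ty} {S : L.Ty} : Var (S :: Γ) S
  | succ {Γ : List L.Ty} {S T : L.Ty} (x : Var Γ S) : Var (T :: Γ) S

/-- The terms of type `S` in a context `Γ`. The arguments of a function symbol are given as a
family indexed by the variables of its context of arguments. -/
inductive Tm (Γ : List L.Ty) : L.Ty → Type (max v w)
  | var {S : L.Ty} (x : Var Γ S) : Tm Γ S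
  | fn {l : List L.Ty} {S : L.Ty} (f : L.Fn l S) (ts : ∀ T : L.Ty, Var l T → Tm Γ T) : Tm Γ S

/-- Formulas of the language `L_st`, with the standardness predicate `st`, in a context `Γ`.
`mem t s` is the formula `t ∈ s`, i.e. `∃ i < |s|, t = sᵢ`; it is taken as atomic because `(s, i) ↦ sᵢ`
is not a total function when `S` is empty. Absurdity counts as an (internal) atomic formula, and
`¬ Φ` is `Φ → ⊥`. -/
inductive Fml : List L.Ty → Type (max v w)
  | falsum {Γ : List L.Ty} : Fml Γ
  | rel {Γ l : List L.Ty} (R : L.Rel l) (ts : ∀ T : L.Ty, Var l T → Tm Γ T) : Fml Γ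
  | eq {Γ : List L.Ty} {S : L.Ty} (s t : Tm Γ S) : Fml Γ
  | mem {Γ : List L.Ty} {S : L.Ty} (t : Tm Γ S) (s : Tm Γ (L.seq S)) : Fml Γ
  | st {Γ : List L.Ty} {S : L.Ty} (t : Tm Γ S) : Fml Γ
  | and {Γ : List L.Ty} (Φ Ψ : Fml Γ) : Fml Γ
  | or {Γ : List L.Ty} (Φ Ψ : Fml Γ) : Fml Γ
  | imp {Γ : List L.Ty} (Φ Ψ : Fml Γ) : Fml Γ
  | all {Γ : List L.Ty} {S : L.Ty} (Φ : Fml (S :: Γ)) : Fml Γ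
  | ex {Γ : List L.Ty} {S : L.Ty} (Φ : Fml (S :: Γ)) : Fml Γ

/-- Internal formulas: those in which `st` does not occur. -/
def Fml.Internal : ∀ {Γ : List L.Ty}, Fml Γ → Prop
  | _, .falsum => True
  | _, .rel _ _ => True
  | _, .eq _ _ => True
  | _, .mem _ _ => True
  | _, .st _ => False
  | _, .and Φ Ψ => Φ.Internal ∧ Ψ.Internal
  | _, .or Φ Ψ => Φ.Internal ∧ Ψ.Internal
  | _, .imp Φ Ψ => Φ.Internal ∧ Ψ.Internal
  | _, .all Φ => Φ.Internal
  | _, .ex Φ => Φ.Internal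

/-- `∨`-free formulas: those in which `∨` does not occur. -/
def Fml.OrFree : ∀ {Γ : List L.Ty}, Fml Γ → Prop
  | _, .falsum => True
  | _, .rel _ _ => True
  | _, .eq _ _ => True
  | _, .mem _ _ => True
  | _, .st _ => True
  | _, .and Φ Ψ => Φ.OrFree ∧ Ψ.OrFree
  | _, .or _ _ => False
  | _, .imp Φ Ψ => Φ.OrFree ∧ Ψ.OrFree
  | _, .all Φ => Φ.OrFree
  | _, .ex Φ => Φ.OrFree

/-! ### Substitution -/

/-- Simultaneous substitutions of terms in context `Δ` for the variables of `Γ`. -/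
abbrev Subst (Γ Δ : List L.Ty) := ∀ T : L.Ty, Var Γ T → Tm Δ T

def Tm.subst {Γ Δ : List L.Ty} (σ : Subst Γ Δ) : ∀ {S : L.Ty}, Tm Γ S → Tm Δ S
  | _, .var x => σ _ x
  | _, .fn f ts => .fn f fun T x => (ts T x).subst σ

/-- Weakening of a term by a new variable. -/
def Tm.weaken {Γ : List L.Ty} {S T : L.Ty} (t : Tm Γ S) : Tm (T :: Γ) S :=
  t.subst fun _ x => .var (.succ x)

/-- Extension of a substitution under a binder. -/
def Subst.lift {Γ Δ : List L.Ty} (σ : Subst Γ Δ) (S : L.Ty) : Subst (S :: Γ) (S :: Δ)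
  | _, .zero => .var .zero
  | _, .succ x => (σ _ x).weaken

def Fml.subst : ∀ {Γ Δ : List L.Ty}, Subst Γ Δ → Fml Γ → Fml Δ
  | _, _, _, .falsum => .falsum
  | _, _, σ, .rel R ts => .rel R fun T x => (ts T x).subst σ
  | _, _, σ, .eq s t => .eq (s.subst σ) (t.subst σ)
  | _, _, σ, .mem t s => .mem (t.subst σ) (s.subst σ)
  | _, _, σ, .st t => .st (t.subst σ)
  | _, _, σ, .and Φ Ψ => .and (Φ.subst σ) (Ψ.subst σ)
  | _, _, σ, .or Φ Ψ => .or (Φ.subst σ) (Ψ.subst σ)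
  | _, _, σ, .imp Φ Ψ => .imp (Φ.subst σ) (Ψ.subst σ)
  | _, _, σ, .all Φ => .all (Φ.subst (Subst.lift σ _))
  | _, _, σ, .ex Φ => .ex (Φ.subst (Subst.lift σ _))

/-! ### Interpretation in sets (of terms) and in the topos `𝒰` -/

/-- The value of a variable, i.e. the projection `S₁ × ⋯ × Sₙ → Sᵢ`. -/
def Var.eval : ∀ {Γ : List L.Ty} {S : L.Ty}, Var Γ S → L.Env Γ → L.El S
  | _, _, .zero, ρ => ρ.head
  | _, _, .succ x, ρ => x.eval ρ.tail

/-- The tuple in `S₁ × ⋯ × Sₙ` with the given components. -/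
def tuple : ∀ {l : List L.Ty}, (∀ T : L.Ty, Var l T → L.El T) → L.Env l
  | [], _ => ⟨⟩
  | _ :: _, a => .cons (a _ .zero) (tuple fun T x => a T (.succ x))

/-- The function `S₁ × ⋯ × Sₙ → S` denoted by a term. -/
def Tm.eval {Γ : List L.Ty} : ∀ {S : L.Ty}, Tm Γ S → L.Env Γ → L.El S
  | _, .var x, ρ => x.eval ρ
  | _, .fn f ts, ρ => L.fnEl f (tuple fun T x => (ts T x).eval ρ)

open FiltObj

/-- The interpretation `⟦Γ⟧ = y(S₁ × ⋯ × Sₙ)` of a context in `𝒰`. -/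
noncomputable abbrev ctx (Γ : List L.Ty) : 𝒰.{u} := y (L.Env Γ)

/-- The interpretation `⟦t⟧ = yt : ⟦Γ⟧ ⟶ ⟦S⟧` of a term in `𝒰`. -/
noncomputable abbrev Tm.interp {Γ : List L.Ty} {S : L.Ty} (t : Tm Γ S) :
    (ctx Γ).obj ⟶ (y (L.El S)).obj :=
  yMap t.eval

/-- The interpretation of a formula `Φ` with variables in `Γ` as a subobject of `⟦Γ⟧` in `𝒰`.
Relation symbols (and absurdity, as the empty relation) are interpreted as the subobjects
represented by their interpretations in sets, and `st` as `Δ₁S ↪ yS`; joins and images in `𝒰`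
are the closures under `K₁` of those of presheaves. -/
noncomputable def Fml.interp : ∀ {Γ : List L.Ty}, Fml Γ → Subfunctor (ctx Γ).obj
  | _, .falsum => ySub ∅
  | _, .rel R ts => (ySub (L.relEl R)).preimage (yMap fun ρ => tuple fun T x => (ts T x).eval ρ)
  | _, .eq s t => (ySub {p : _ × _ | p.1 = p.2}).preimage (yMap fun ρ => (s.eval ρ, t.eval ρ))
  | _, .mem (S := S) t s =>
      (ySub {p : L.El S × L.El (L.seq S) | p.1 ∈ L.seqEquiv S p.2}).preimage
        (yMap fun ρ => (t.eval ρ, s.eval ρ))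
  | _, .st (S := S) t => (Δ₁ (L.El S)).preimage t.interp
  | _, .and Φ Ψ => Φ.interp ⊓ Ψ.interp
  | _, .or Φ Ψ => (Φ.interp ⊔ Ψ.interp).sheafify K₁
  | _, .imp Φ Ψ => impl Φ.interp Ψ.interp
  | _, .all Φ => forallAlong (yMap Env.tail) Φ.interp
  | _, .ex Φ => (Φ.interp.image (yMap Env.tail)).sheafify K₁

theorem sheafCtx (Γ : List L.Ty) : Presieve.IsSheaf K₁ (ctx Γ).obj :=
  (isSheaf_iff_isSheaf_of_type _ _).1 (ctx Γ).property

/-- The interpretation of a formula is a subobject of `⟦Γ⟧` in `𝒰`, not just in presheaves. -/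
theorem Fml.isClosed_interp {Γ : List L.Ty} (Φ : Fml Γ) : IsClosed Φ.interp := by
  induction Φ with
  | falsum => exact isClosed_ySub _
  | rel R ts => exact (isClosed_ySub _).preimage _
  | eq s t => exact (isClosed_ySub _).preimage _
  | mem t s => exact (isClosed_ySub _).preimage _
  | st t => exact (isClosed_Δ₁ _).preimage _
  | and Φ Ψ h h' => exact h.inf h'
  | or Φ Ψ h h' =>
      exact (isClosed_iff_isSheaf (sheafCtx _) _).2 (Subfunctor.sheafify_isSheaf _ (sheafCtx _))
  | imp Φ Ψ h h' => exact .impl _ h'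
  | all Φ h => exact .forallAlong _ h
  | ex Φ h =>
      exact (isClosed_iff_isSheaf (sheafCtx _) _).2 (Subfunctor.sheafify_isSheaf _ (sheafCtx _))

/-- The interpretation of a formula, as an object of `𝒰`. -/
noncomputable def Fml.interpObj {Γ : List L.Ty} (Φ : Fml Γ) : 𝒰.{u} :=
  ⟨Φ.interp.toFunctor, (isSheaf_iff_isSheaf_of_type _ _).2
    ((isClosed_iff_isSheaf (sheafCtx Γ) _).1
      Φ.isClosed_interp)⟩

/-- The forcing relation `F ⊩ Φ(α)` of `𝒰`, for `α ∈ ⟦Γ⟧F`. -/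
def Forces (F : FiltObj.{u}) {Γ : List L.Ty} (Φ : Fml Γ) (α : F ⟶ simple (L.Env Γ)) : Prop :=
  α ∈ Φ.interp.obj (op F)

/-- `Φ` holds in `𝒰`: it is forced at all filters, for all values of its free variables. -/
def Holds {Γ : List L.Ty} (Φ : Fml Γ) : Prop :=
  ∀ (F : FiltObj.{u}) (α : F ⟶ simple (L.Env Γ)), Forces F Φ α

/-! ### The principles -/

namespace Fml

variable {Γ : List L.Ty} {S T : L.Ty}

/-- `∀ˢᵗ x : S, Φ(x)` -/
def allSt (Φ : Fml (S :: Γ)) : Fml Γ := .all (.imp (.st (.var .zero)) Φ)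

/-- `∃ˢᵗ x : S, Φ(x)` -/
def exSt (Φ : Fml (S :: Γ)) : Fml Γ := .ex (.and (.st (.var .zero)) Φ)

/-- `hyper(s)`: the sequence `s : S*` contains all standard elements of `S`. -/
def hyper (s : Tm Γ (L.seq S)) : Fml Γ := allSt (.mem (.var .zero) s.weaken)

/-- `∀ʰʸᵖ s : S*, Φ(s)` -/
def allHyp (Φ : Fml (L.seq S :: Γ)) : Fml Γ := .all (.imp (hyper (.var .zero)) Φ)

/-- `∃ʰʸᵖ s : S*, Φ(s)` -/
def exHyp (Φ : Fml (L.seq S :: Γ)) : Fml Γ := .ex (.and (hyper (.var .zero)) Φ)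

/-- Sequence overspill `∀ˢᵗ s : S*, φ(s) → ∃ʰʸᵖ s : S*, φ(s)`. -/
def OS (φ : Fml (L.seq S :: Γ)) : Fml Γ := .imp (allSt φ) (exHyp φ)

/-- Sequence underspill `∀ʰʸᵖ s : S*, φ(s) → ∃ˢᵗ s : S*, φ(s)`. -/
def US (φ : Fml (L.seq S :: Γ)) : Fml Γ := .imp (allHyp φ) (exSt φ)

/-- The substitution `Γ, x → Γ, y, x` which inserts an unused variable `y`. -/
def insertVar (Γ : List L.Ty) (S T : L.Ty) : Subst (S :: Γ) (S :: T :: Γ)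
  | _, .zero => .var .zero
  | _, .succ z => .var (.succ (.succ z))

/-- Independence of premise
`(∀ˢᵗ x : S, φ(x) → ∃ˢᵗ y : T, Ψ(y)) → ∃ˢᵗ y : T, (∀ˢᵗ x : S, φ(x) → Ψ(y))`. -/
def IP (φ : Fml (S :: Γ)) (Ψ : Fml (T :: Γ)) : Fml Γ :=
  .imp (.imp (allSt φ) (exSt Ψ)) (exSt (.imp (allSt (φ.subst (insertVar Γ S T))) Ψ))

/-- The substitution `Γ, y, x → Γ, x, y` which exchanges the last two variables. -/
def swapVar (Γ : List L.Ty) (S T : L.Ty) : Subst (S :: T :: Γ) (T :: S :: Γ)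
  | _, .zero => .var (.succ .zero)
  | _, .succ .zero => .var .zero
  | _, .succ (.succ z) => .var (.succ (.succ z))

/-- Nonstandard uniformity `∀ y : T, ∃ˢᵗ x : S, Φ(x, y) → ∃ˢᵗ x : S, ∀ y : T, Φ(x, y)`. -/
def NU (Φ : Fml (S :: T :: Γ)) : Fml Γ :=
  .imp (.all (exSt Φ)) (exSt (.all (Φ.subst (swapVar Γ S T))))

end Fml

/-- A type of `L` that denotes the set of functions `S → T`, with the symbol for application. -/
structure FunctionType (L : SetLanguage.{u, v, w}) (S T : L.Ty) where
  ty : L.Ty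
  equiv : L.El ty ≃ (L.El S → L.El T)
  app : L.Fn [ty, S] T
  app_eq : ∀ (f : L.El ty) (x : L.El S), L.fnEl app (Env.cons f (Env.cons x ⟨⟩)) = equiv f x

/-- The term `f(x)`, for `f : S → T` and `x : S`. -/
def FunctionType.apply {S T : L.Ty} (P : L.FunctionType S T) {Γ : List L.Ty} (f : Tm Γ P.ty)
    (x : Tm Γ S) : Tm Γ T :=
  .fn P.app fun
    | _, .zero => f
    | _, .succ .zero => x

namespace Fml

/-- The substitution `Γ, x, y → Γ, f, x` with `y := f(x)`. -/
def applySubst (Γ : List L.Ty) {S T : L.Ty} (P : L.FunctionType S T) :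
    Subst (T :: S :: Γ) (S :: P.ty :: Γ)
  | _, .zero => P.apply (.var (.succ .zero)) (.var .zero)
  | _, .succ .zero => .var .zero
  | _, .succ (.succ z) => .var (.succ (.succ z))

/-- The axiom of choice
`∀ˢᵗ x : S, ∃ˢᵗ y : T, Φ(x, y) → ∃ˢᵗ f : S → T, ∀ˢᵗ x : S, Φ(x, f(x))`. -/
def AC {Γ : List L.Ty} {S T : L.Ty} (P : L.FunctionType S T) (Φ : Fml (T :: S :: Γ)) : Fml Γ :=
  .imp (allSt (exSt Φ)) (exSt (allSt (Φ.subst (applySubst Γ P))))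

end Fml

end SetLanguage

/-! Standard elements of `S` are constant germs, that is, actual elements of the set. Hence `∀ˢᵗ` is
forced exactly when each element of the set is a good value (`forces_allSt`). Moreover, `∃ˢᵗ` has a
single witness valid on the whole filter (`forces_exSt`): a witness found on a cover is a constant,
which makes sense below the cover as well, and forcing descends along covers. This already gives
`AC`: one chooses a witness for each element.

The other principles evaluate a formula at a generic object. For a filter base `Q j` of subsets of
`C × A` and a germ `α` into `A`, `exists_classifying` builds over `F` the filter of pairs whose base
sets are cut out by the `Q j`. Its projection to `F` covers as soon as the fibres of every `Q j` are
inhabited near `α`, and all germs lying in every `Q j` factor through it. For `NU` the generic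
object is an element of `T`: the single `x` that works for it works for all `y`, by pullback. For
`IP` it is the largest restriction of the filter that forces the premise.

Overspill and underspill also need `forces_iff_within_truth`: an internal `∨`-free formula is forced
iff it is true on a base set. Sequences containing the entries of a given finite sequence `t` form a
filter base as `t` varies, and its generic element is a hyper sequence. For overspill the base sets
are also intersected with the truth set of `φ`, and `t` itself witnesses that they are inhabited;
for underspill, truth of `φ` at the generic sequence means truth for all sequences containing some
`t`, in particular for `t`. -/

namespace FiltObj

/-! ### Germs into sets, their products, and membership in a subset. -/

variable {F G : FiltObj.{u}} {A B C : Type u}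

/-- The germ `α : F ⟶ A` takes values in `P ⊆ A`, i.e. it is a section of the subobject `ySub P`. -/
def Within (α : F ⟶ simple A) (P : Set A) : Prop :=
  α ∈ (ySub P).obj (op F)

/-- The domain of `PartialMap.comp` is picked by choice. This representative keeps the domain of
`p`, so that values can be compared pointwise. -/
theorem exists_germ_comp_simpleMap (p : PartialMap F (simple A)) (f : A → B) :
    ∃ q : PartialMap F (simple B), germ p ≫ simpleMap f = germ q ∧ q.idx = p.idx ∧
      ∀ a ha hb, q.toFun ⟨a, hb⟩ = f (p.toFun ⟨a, ha⟩) := by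
  refine ⟨⟨p.idx, fun a => f (p.toFun a), fun _ => ⟨p.idx, fun a ha => ⟨ha, trivial⟩⟩⟩, ?_, rfl,
    fun a ha hb => rfl⟩
  refine (germ_eq_iff _ _).2 ?_
  obtain ⟨k, hk⟩ := F.directed p.idx (p.comp (PartialMap.ofTotal (F := simple A) (G := simple B) f
    fun _ => ⟨Classical.choice (simple A).inhabited, fun _ _ => trivial⟩)).idx
  exact ⟨k, fun a ha => ⟨(hk ha).2, (hk ha).1, rfl⟩⟩

theorem germ_eq_germ_comp_simpleMap {p : PartialMap F (simple A)} {q : PartialMap F (simple B)}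
    {f : A → B} : germ p ≫ simpleMap f = germ q ↔
      ∃ k, ∀ a ∈ F.base k, ∃ (hp : a ∈ F.base p.idx) (hq : a ∈ F.base q.idx),
        f (p.toFun ⟨a, hp⟩) = q.toFun ⟨a, hq⟩ := by
  obtain ⟨r, hr, hi, hv⟩ := exists_germ_comp_simpleMap p f
  rw [hr, germ_eq_iff]
  constructor
  · rintro ⟨k, hk⟩
    refine ⟨k, fun a ha => ?_⟩
    obtain ⟨h1, h2, h3⟩ := hk a ha
    exact ⟨hi ▸ h1, h2, (hv a _ _).symm.trans h3⟩
  · rintro ⟨k, hk⟩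
    refine ⟨k, fun a ha => ?_⟩
    obtain ⟨h1, h2, h3⟩ := hk a ha
    exact ⟨hi ▸ h1, h2, (hv a h1 _).trans h3⟩

/-- Shrinking the domain to a base set that `p` maps into `P` produces the factorization through the
inclusion of `P`. All later reasoning about `ySub` passes through this description. -/
theorem within_germ {p : PartialMap F (simple A)} {P : Set A} :
    Within (germ p) P ↔ ∃ k, ∀ a ∈ F.base k, ∃ h : a ∈ F.base p.idx, p.toFun ⟨a, h⟩ ∈ P := by
  constructor
  · rintro ⟨β, hβ⟩
    change β ≫ simpleMap _ = germ p at hβ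
    obtain ⟨q, rfl⟩ := exists_germ β
    obtain ⟨k, hk⟩ := germ_eq_germ_comp_simpleMap.1 hβ
    refine ⟨k, fun a ha => ?_⟩
    obtain ⟨h1, h2, h3⟩ := hk a ha
    exact ⟨h2, h3 ▸ Subtype.property _⟩
  · rintro ⟨k, hk⟩
    refine ⟨germ (G := simple P) ⟨k, fun a => ⟨p.toFun ⟨a, (hk a a.2).1⟩, (hk a a.2).2⟩,
      fun _ => ⟨k, fun a ha => ⟨ha, trivial⟩⟩⟩, ?_⟩
    refine germ_eq_germ_comp_simpleMap.2 ⟨k, fun a ha => ⟨ha, (hk a ha).1, rfl⟩⟩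

theorem simpleMap_comp (f : A → B) (g : B → C) :
    simpleMap f ≫ simpleMap g = simpleMap (g ∘ f) :=
  germ_eq_germ_comp_simpleMap.2 ⟨⟨⟩, fun _ _ => ⟨trivial, trivial, rfl⟩⟩

theorem germ_comp_simpleMap_comp (α : F ⟶ simple A) (f : A → B) (g : B → C) :
    (α ≫ simpleMap f) ≫ simpleMap g = α ≫ simpleMap (g ∘ f) := by
  rw [Category.assoc, simpleMap_comp]

theorem comp_simpleMap_const (α : F ⟶ simple A) (x : B) :
    α ≫ simpleMap (fun _ => x) = const F x :=
  comp_const α x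

theorem within_comp_simpleMap {α : F ⟶ simple A} {f : A → B} {P : Set B} :
    Within (α ≫ simpleMap f) P ↔ Within α (f ⁻¹' P) := by
  obtain ⟨p, rfl⟩ := exists_germ α
  obtain ⟨q, hq, hi, hv⟩ := exists_germ_comp_simpleMap p f
  rw [hq, within_germ, within_germ]
  constructor
  · rintro ⟨k, hk⟩
    refine ⟨k, fun a ha => ?_⟩
    obtain ⟨h1, h2⟩ := hk a ha
    exact ⟨hi ▸ h1, (congrArg (· ∈ P) (hv a (hi ▸ h1) h1)).mp h2⟩
  · rintro ⟨k, hk⟩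
    refine ⟨k, fun a ha => ?_⟩
    obtain ⟨h1, h2⟩ := hk a ha
    exact ⟨hi ▸ h1, (congrArg (· ∈ P) (hv a h1 (hi.symm ▸ h1))).mpr h2⟩

theorem Within.comp {α : F ⟶ simple A} {P : Set A} (h : Within α P) (f : G ⟶ F) :
    Within (f ≫ α) P :=
  (ySub P).map f.op h

theorem Within.mono {α : F ⟶ simple A} {P Q : Set A} (h : Within α P) (hPQ : P ⊆ Q) :
    Within α Q := by
  obtain ⟨p, rfl⟩ := exists_germ α
  obtain ⟨k, hk⟩ := within_germ.1 h
  exact within_germ.2 ⟨k, fun a ha => ⟨(hk a ha).1, hPQ (hk a ha).2⟩⟩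

theorem within_inter {α : F ⟶ simple A} {P Q : Set A} :
    Within α (P ∩ Q) ↔ Within α P ∧ Within α Q := by
  refine ⟨fun h => ⟨h.mono Set.inter_subset_left, h.mono Set.inter_subset_right⟩, ?_⟩
  rintro ⟨h, h'⟩
  obtain ⟨p, rfl⟩ := exists_germ α
  obtain ⟨k, hk⟩ := within_germ.1 h
  obtain ⟨l, hl⟩ := within_germ.1 h'
  obtain ⟨m, hm⟩ := F.directed k l
  exact within_germ.2 ⟨m, fun a ha => ⟨(hk a (hm ha).1).1, (hk a (hm ha).1).2,
    (hl a (hm ha).2).2⟩⟩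

theorem within_univ (α : F ⟶ simple A) : Within α Set.univ := by
  obtain ⟨p, rfl⟩ := exists_germ α
  exact within_germ.2 ⟨p.idx, fun a ha => ⟨ha, trivial⟩⟩

/-- Together with `germ_pair_ext`, this makes `simple (A × B)` the product in `𝔉Set`; the pairing
lives on a base set common to both domains. -/
theorem exists_germ_pair (α : F ⟶ simple A) (β : F ⟶ simple B) :
    ∃ γ : F ⟶ simple (A × B), γ ≫ simpleMap Prod.fst = α ∧ γ ≫ simpleMap Prod.snd = β := by
  obtain ⟨p, rfl⟩ := exists_germ α
  obtain ⟨q, rfl⟩ := exists_germ β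
  obtain ⟨k, hk⟩ := F.directed p.idx q.idx
  refine ⟨germ (G := simple (A × B)) ⟨k, fun a => (p.toFun ⟨a, (hk a.2).1⟩,
    q.toFun ⟨a, (hk a.2).2⟩), fun _ => ⟨k, fun a ha => ⟨ha, trivial⟩⟩⟩, ?_, ?_⟩
  · exact germ_eq_germ_comp_simpleMap.2 ⟨k, fun a ha => ⟨ha, (hk ha).1, rfl⟩⟩
  · exact germ_eq_germ_comp_simpleMap.2 ⟨k, fun a ha => ⟨ha, (hk ha).2, rfl⟩⟩

theorem germ_pair_ext {α β : F ⟶ simple (A × B)}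
    (h : α ≫ simpleMap Prod.fst = β ≫ simpleMap Prod.fst)
    (h' : α ≫ simpleMap Prod.snd = β ≫ simpleMap Prod.snd) : α = β := by
  obtain ⟨p, rfl⟩ := exists_germ α
  obtain ⟨q, rfl⟩ := exists_germ β
  obtain ⟨r, hr, hi, hv⟩ := exists_germ_comp_simpleMap q Prod.fst
  obtain ⟨s, hs, hi', hv'⟩ := exists_germ_comp_simpleMap q Prod.snd
  obtain ⟨k, hk⟩ := germ_eq_germ_comp_simpleMap.1 (h.trans hr)
  obtain ⟨l, hl⟩ := germ_eq_germ_comp_simpleMap.1 (h'.trans hs)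
  obtain ⟨m, hm⟩ := F.directed k l
  refine (germ_eq_iff _ _).2 ⟨m, fun a ha => ?_⟩
  obtain ⟨h1, h2, h3⟩ := hk a (hm ha).1
  obtain ⟨_, h5, h6⟩ := hl a (hm ha).2
  have hq : a ∈ F.base q.idx := hi ▸ h2
  exact ⟨h1, hq, Prod.ext (h3.trans (hv a hq h2)) (h6.trans (hv' a hq h5))⟩

/-- The filter over `F` that classifies the germs `c` into `C` for which `(c, α)` lies in all the
sets of a filter base `Q` on `C × A`. -/
theorem exists_classifying (α : F ⟶ simple A) {J : Type u} [Nonempty J] (Q : J → Set (C × A))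
    (hQ : ∀ i j, ∃ k, Q k ⊆ Q i ∩ Q j) :
    ∃ (G : FiltObj.{u}) (π : G ⟶ F) (z : G ⟶ simple (C × A)),
      z ≫ simpleMap Prod.snd = π ≫ α ∧
      (∀ P : Set (C × A), Within z P ↔ ∃ j, Within α {x | ∀ c, (c, x) ∈ Q j → (c, x) ∈ P}) ∧
      ((∀ j, Within α {x | ∃ c, (c, x) ∈ Q j}) → Covering π) ∧
      ∀ (H : FiltObj.{u}) (f : H ⟶ F) (y : H ⟶ simple (C × A)),
        y ≫ simpleMap Prod.snd = f ≫ α → (∀ j, Within y (Q j)) →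
        ∃ g : H ⟶ G, g ≫ π = f ∧ g ≫ z = y := by
  obtain ⟨p, rfl⟩ := exists_germ α
  -- The representative `p` of `α` is only partial, so each base set also requires its points to lie
  -- over the domain of `p`.
  let G : FiltObj.{u} :=
    { carrier := C × F.carrier
      Idx := F.Idx × J
      base := fun i => {x | x.2 ∈ F.base i.1 ∧
        ∃ h : x.2 ∈ F.base p.idx, (x.1, p.toFun ⟨x.2, h⟩) ∈ Q i.2}
      inhabited := ⟨(p.idx, Classical.arbitrary J)⟩
      directed := by
        rintro ⟨i, j⟩ ⟨i', j'⟩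
        obtain ⟨k, hk⟩ := F.directed i i'
        obtain ⟨l, hl⟩ := hQ j j'
        exact ⟨(k, l), fun x ⟨hx, h, h'⟩ => ⟨⟨(hk hx).1, h, (hl h').1⟩,
          ⟨(hk hx).2, h, (hl h').2⟩⟩⟩ }
  -- Any base set serves as the common domain of `π` and `z`, since all of them lie over the domain
  -- of `p`.
  let i₀ : G.Idx := Classical.choice G.inhabited
  let π : PartialMap G F := ⟨i₀, fun x => x.1.2, fun i => by
    obtain ⟨k, hk⟩ := G.directed i₀ (i, i₀.2)
    exact ⟨k, fun x hx => ⟨(hk hx).1, (hk hx).2.1⟩⟩⟩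
  let z : PartialMap G (simple (C × A)) := ⟨i₀, fun x => (x.1.1, p.toFun ⟨x.1.2, x.2.2.choose⟩),
    fun _ => ⟨i₀, fun x hx => ⟨hx, trivial⟩⟩⟩
  refine ⟨G, germ π, germ z, ?_, fun P => ?_, fun h => ?_, fun H f y h hy => ?_⟩
  · rw [germ_comp]
    obtain ⟨k, hk⟩ := G.directed i₀ (π.comp p).idx
    exact germ_eq_germ_comp_simpleMap.2 ⟨k, fun x hx => ⟨(hk hx).1, (hk hx).2, rfl⟩⟩
  · rw [within_germ]
    constructor
    · rintro ⟨⟨i, j⟩, hij⟩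
      refine ⟨j, within_germ.2 ?_⟩
      obtain ⟨k, hk⟩ := F.directed i p.idx
      exact ⟨k, fun a ha => ⟨(hk ha).2, fun c hc =>
        (hij (c, a) ⟨(hk ha).1, (hk ha).2, hc⟩).choose_spec⟩⟩
    · rintro ⟨j, hj⟩
      obtain ⟨i, hi⟩ := within_germ.1 hj
      obtain ⟨k, hk⟩ := G.directed (i, j) i₀
      refine ⟨k, fun x hx => ⟨(hk hx).2, ?_⟩⟩
      obtain ⟨h1, h2, h3⟩ := (hk hx).1
      exact (hi x.2 h1).2 x.1 h3
  · intro i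
    obtain ⟨⟨k, j⟩, hk⟩ := G.directed i i₀
    obtain ⟨l, hl⟩ := within_germ.1 (h j)
    obtain ⟨m, hm⟩ := F.directed k l
    refine ⟨m, fun a ha => ?_⟩
    obtain ⟨h1, c, hc⟩ := hl a (hm ha).2
    have hx : (c, a) ∈ G.base (k, j) := ⟨(hm ha).1, h1, hc⟩
    exact ⟨(c, a), (hk hx).1, (hk hx).2, rfl⟩
  · obtain ⟨f, rfl⟩ := exists_germ f
    obtain ⟨y, rfl⟩ := exists_germ y
    rw [germ_comp] at h
    obtain ⟨m, hm⟩ := germ_eq_germ_comp_simpleMap.1 h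
    have hm' : ∀ a ∈ H.base m, ∃ (hy : a ∈ H.base y.idx) (hf : a ∈ H.base f.idx)
        (hp : f.toFun ⟨a, hf⟩ ∈ F.base p.idx),
        y.toFun ⟨a, hy⟩ = ((y.toFun ⟨a, hy⟩).1, p.toFun ⟨f.toFun ⟨a, hf⟩, hp⟩) := by
      intro a ha
      obtain ⟨h1, h2, h3⟩ := hm a ha
      obtain ⟨h4, h5, h6⟩ := PartialMap.comp_toFun f p a h2
      exact ⟨h1, h4, h5, Prod.ext rfl (h3.trans h6)⟩
    choose d₁ d₂ d₃ e using hm'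
    -- On the base set `m` the second component of `y` is `p` applied to `f`, so the first component
    -- of `y` and `f` determine the map into `G`; continuity is exactly `hy` together with
    -- continuity of `f`.
    let g : PartialMap H G := ⟨m, fun a => ((y.toFun ⟨a, d₁ a a.2⟩).1, f.toFun ⟨a, d₂ a a.2⟩), by
      rintro ⟨i, j⟩
      obtain ⟨k, hk⟩ := f.cont i
      obtain ⟨l, hl⟩ := within_germ.1 (hy j)
      obtain ⟨n, hn⟩ := H.directed k l
      obtain ⟨o, ho⟩ := H.directed n m
      refine ⟨o, fun a ha => ⟨(ho ha).2, (hk a (hn (ho ha).1).1).2, d₃ a (ho ha).2, ?_⟩⟩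
      rw [← e a (ho ha).2]
      exact (hl a (hn (ho ha).1).2).2⟩
    refine ⟨germ g, ?_, ?_⟩
    · rw [germ_comp]
      obtain ⟨k, hk⟩ := H.directed (g.comp π).idx m
      exact (germ_eq_iff _ _).2 ⟨k, fun a ha => ⟨(hk ha).1, d₂ a (hk ha).2, rfl⟩⟩
    · rw [germ_comp]
      obtain ⟨k, hk⟩ := H.directed (g.comp z).idx m
      exact (germ_eq_iff _ _).2 ⟨k, fun a ha => ⟨(hk ha).1, d₁ a (hk ha).2, (e a (hk ha).2).symm⟩⟩

end FiltObj

namespace SetLanguage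

open FiltObj

variable {L : SetLanguage.{u, v, w}} {Γ Δ : List L.Ty} {S T : L.Ty} {F G : FiltObj.{u}}

/-! ### Terms and substitution -/

theorem Var.eval_tuple {Γ : List L.Ty} (a : ∀ T : L.Ty, Var Γ T → L.El T) {S : L.Ty}
    (x : Var Γ S) : x.eval (tuple a) = a S x := by
  induction x with
  | zero => rfl
  | succ x ih => exact ih fun T x => a T (.succ x)

theorem tuple_eval : ∀ {Γ : List L.Ty} (ρ : L.Env Γ), tuple (fun _ x => Var.eval x ρ) = ρ
  | [], _ => rfl
  | _ :: _, ρ => congrArg (Env.cons ρ.head) (tuple_eval ρ.tail)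

/-- The function `⟦Δ⟧ → ⟦Γ⟧` denoted by a substitution of terms in `Δ` for the variables of `Γ`. -/
def Subst.env (σ : Subst Γ Δ) (ρ : L.Env Δ) : L.Env Γ := tuple fun T x => (σ T x).eval ρ

theorem Tm.eval_subst (σ : Subst Γ Δ) (t : Tm Γ S) (ρ : L.Env Δ) :
    (t.subst σ).eval ρ = t.eval (σ.env ρ) := by
  induction t with
  | var x => exact (Var.eval_tuple (fun T x => (σ T x).eval ρ) x).symm
  | fn f ts ih => exact congrArg (fun a => L.fnEl f (tuple a)) (by funext T x; exact ih T x)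

theorem Tm.eval_weaken (t : Tm Γ S) (ρ : L.Env (T :: Γ)) : t.weaken.eval ρ = t.eval ρ.tail :=
  (t.eval_subst _ ρ).trans (congrArg t.eval (tuple_eval ρ.tail))

theorem Subst.env_lift (σ : Subst Γ Δ) (ρ : L.Env (S :: Δ)) :
    (Subst.lift σ S).env ρ = Env.cons ρ.head (σ.env ρ.tail) :=
  congrArg (fun a => Env.cons ρ.head (tuple a)) (by funext T x; exact (σ T x).eval_weaken ρ)

/-! ### The forcing relation -/

theorem forces_mono {Φ : Fml Γ} {α : F ⟶ simple (L.Env Γ)} (h : Forces F Φ α) (f : G ⟶ F) :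
    Forces G Φ (f ≫ α) :=
  Φ.interp.map f.op h

theorem Forces.of_covering {Φ : Fml Γ} {α : F ⟶ simple (L.Env Γ)} {f : G ⟶ F} (hf : Covering f)
    (h : Forces G Φ (f ≫ α)) : Forces F Φ α :=
  Φ.isClosed_interp f hf α h

theorem forces_rel {l : List L.Ty} {R : L.Rel l} {ts : ∀ T : L.Ty, Var l T → Tm Γ T}
    {α : F ⟶ simple (L.Env Γ)} :
    Forces F (.rel R ts) α ↔ Within α {ρ | tuple (fun T x => (ts T x).eval ρ) ∈ L.relEl R} :=
  within_comp_simpleMap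

theorem forces_eq {s t : Tm Γ S} {α : F ⟶ simple (L.Env Γ)} :
    Forces F (.eq s t) α ↔ Within α {ρ | s.eval ρ = t.eval ρ} :=
  within_comp_simpleMap

theorem forces_mem {t : Tm Γ S} {s : Tm Γ (L.seq S)} {α : F ⟶ simple (L.Env Γ)} :
    Forces F (.mem t s) α ↔ Within α {ρ | t.eval ρ ∈ L.seqEquiv S (s.eval ρ)} :=
  within_comp_simpleMap

/-- A cover is a single morphism, so one disjunct must hold on all of it. Truth of a union on a base
set does not provide this, which is why `∨` is excluded from `forces_iff_within_truth`. -/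
theorem forces_or {Φ Ψ : Fml Γ} {α : F ⟶ simple (L.Env Γ)} :
    Forces F (.or Φ Ψ) α ↔ ∃ (G : FiltObj.{u}) (f : G ⟶ F), Covering f ∧
      (Forces G Φ (f ≫ α) ∨ Forces G Ψ (f ≫ α)) :=
  ⟨fun ⟨G, f, h, hf⟩ => ⟨G, f, hf, h⟩, fun ⟨G, f, hf, h⟩ => ⟨G, f, h, hf⟩⟩

theorem forces_imp {Φ Ψ : Fml Γ} {α : F ⟶ simple (L.Env Γ)} :
    Forces F (.imp Φ Ψ) α ↔
      ∀ (G : FiltObj.{u}) (f : G ⟶ F), Forces G Φ (f ≫ α) → Forces G Ψ (f ≫ α) :=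
  ⟨fun h _ f => h f.op, fun h _ f => h _ f.unop⟩

theorem Forces.mp {Φ Ψ : Fml Γ} {α : F ⟶ simple (L.Env Γ)} (h : Forces F (.imp Φ Ψ) α)
    (h' : Forces F Φ α) : Forces F Ψ α := by
  have := forces_imp.1 h F (𝟙 F)
  rw [Category.id_comp α] at this
  exact this h'

theorem forces_all {Φ : Fml (S :: Γ)} {α : F ⟶ simple (L.Env Γ)} :
    Forces F (.all Φ) α ↔ ∀ (G : FiltObj.{u}) (f : G ⟶ F) (z : G ⟶ simple (L.Env (S :: Γ))),
      z ≫ simpleMap Env.tail = f ≫ α → Forces G Φ z :=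
  ⟨fun h _ f z => h f.op z, fun h _ f z => h _ f.unop z⟩

theorem forces_ex {Φ : Fml (S :: Γ)} {α : F ⟶ simple (L.Env Γ)} :
    Forces F (.ex Φ) α ↔ ∃ (G : FiltObj.{u}) (f : G ⟶ F) (z : G ⟶ simple (L.Env (S :: Γ))),
      Covering f ∧ z ≫ simpleMap Env.tail = f ≫ α ∧ Forces G Φ z :=
  ⟨fun ⟨G, f, ⟨z, h, e⟩, hf⟩ => ⟨G, f, z, hf, e, h⟩,
    fun ⟨G, f, z, hf, e, h⟩ => ⟨G, f, ⟨z, h, e⟩, hf⟩⟩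

theorem env_germ_ext {α β : F ⟶ simple (L.Env (S :: Γ))}
    (h : α ≫ simpleMap Env.head = β ≫ simpleMap Env.head)
    (h' : α ≫ simpleMap Env.tail = β ≫ simpleMap Env.tail) : α = β :=
  germ_pair_ext h h'

theorem exists_env_germ (s : F ⟶ simple (L.El S)) (α : F ⟶ simple (L.Env Γ)) :
    ∃ z : F ⟶ simple (L.Env (S :: Γ)),
      z ≫ simpleMap Env.head = s ∧ z ≫ simpleMap Env.tail = α :=
  exists_germ_pair s α

/-- The instance of `exists_classifying` that adjoins a new variable to the context. -/
theorem exists_classifying_var (α : F ⟶ simple (L.Env Γ)) {J : Type u} [Nonempty J]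
    (Q : J → Set (L.Env (S :: Γ))) (hQ : ∀ i j, ∃ k, Q k ⊆ Q i ∩ Q j) :
    ∃ (G : FiltObj.{u}) (π : G ⟶ F) (z : G ⟶ simple (L.Env (S :: Γ))),
      z ≫ simpleMap Env.tail = π ≫ α ∧
      (∀ P : Set (L.Env (S :: Γ)),
        Within z P ↔ ∃ j, Within α {ρ | ∀ s, Env.cons s ρ ∈ Q j → Env.cons s ρ ∈ P}) ∧
      ((∀ j, Within α {ρ | ∃ s, Env.cons s ρ ∈ Q j}) → Covering π) ∧
      ∀ (H : FiltObj.{u}) (f : H ⟶ F) (y : H ⟶ simple (L.Env (S :: Γ))),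
        y ≫ simpleMap Env.tail = f ≫ α → (∀ j, Within y (Q j)) →
        ∃ g : H ⟶ G, g ≫ π = f ∧ g ≫ z = y :=
  exists_classifying α Q hQ

/-- Every clause of the interpretation is stable under pullback along the map denoted by `σ`. Only
the quantifiers need an argument: the square of `Env.tail` and the lifted substitution is a
pullback. -/
theorem forces_subst {Φ : Fml Γ} (σ : Subst Γ Δ) {α : F ⟶ simple (L.Env Δ)} :
    Forces F (Φ.subst σ) α ↔ Forces F Φ (α ≫ simpleMap σ.env) := by
  have tail_lift : ∀ {Γ Δ : List L.Ty} {S : L.Ty} (σ : Subst Γ Δ) {G : FiltObj.{u}}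
      (z : G ⟶ simple (L.Env (S :: Δ))), (z ≫ simpleMap (Subst.lift σ S).env) ≫
      simpleMap Env.tail = (z ≫ simpleMap Env.tail) ≫ simpleMap σ.env := by
    intro Γ Δ S σ G z
    rw [Category.assoc, Category.assoc, simpleMap_comp, simpleMap_comp]
    congr 2
    funext ρ
    exact congrArg Env.tail (σ.env_lift ρ)
  -- Existence half of the pullback property: the lift takes its head from `z` and its tail from
  -- `β`.
  have exists_lift : ∀ {Γ Δ : List L.Ty} {S : L.Ty} (σ : Subst Γ Δ) {G : FiltObj.{u}}
      (β : G ⟶ simple (L.Env Δ)) (z : G ⟶ simple (L.Env (S :: Γ))),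
      z ≫ simpleMap Env.tail = β ≫ simpleMap σ.env →
      ∃ y : G ⟶ simple (L.Env (S :: Δ)), y ≫ simpleMap Env.tail = β ∧
        y ≫ simpleMap (Subst.lift σ S).env = z := by
    intro Γ Δ S σ G β z h
    obtain ⟨y, h1, h2⟩ := exists_env_germ (z ≫ simpleMap Env.head) β
    refine ⟨y, h2, env_germ_ext ?_ ?_⟩
    · rw [← h1, Category.assoc, simpleMap_comp]
      rfl
    · rw [h, ← h2]
      exact tail_lift σ y
  induction Φ generalizing Δ F with
  | falsum => exact (within_comp_simpleMap (f := σ.env) (P := ∅)).symm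
  | rel R ts =>
      refine forces_rel.trans (Iff.trans ?_ (forces_rel.trans within_comp_simpleMap).symm)
      simp only [Tm.eval_subst]
      rfl
  | eq s t =>
      refine forces_eq.trans (Iff.trans ?_ (forces_eq.trans within_comp_simpleMap).symm)
      simp only [Tm.eval_subst]
      rfl
  | mem t s =>
      refine forces_mem.trans (Iff.trans ?_ (forces_mem.trans within_comp_simpleMap).symm)
      simp only [Tm.eval_subst]
      rfl
  | st t =>
      refine exists_congr fun x => ?_
      change α ≫ simpleMap _ = _ ↔ (α ≫ simpleMap _) ≫ simpleMap _ = _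
      rw [Category.assoc, simpleMap_comp]
      have : (t.subst σ).eval = t.eval ∘ σ.env := funext (t.eval_subst σ)
      rw [this]
  | and Φ Ψ h h' => exact and_congr (h σ) (h' σ)
  | or Φ Ψ h h' =>
      refine forces_or.trans (Iff.trans ?_ forces_or.symm)
      simp only [h, h', Category.assoc]
  | imp Φ Ψ h h' =>
      refine forces_imp.trans (Iff.trans ?_ forces_imp.symm)
      simp only [h, h', Category.assoc]
  | all Φ ih =>
      refine forces_all.trans (Iff.trans ⟨fun h G f z e => ?_, fun h G f z e => ?_⟩
        forces_all.symm)
      · obtain ⟨y, hy, rfl⟩ := exists_lift σ (f ≫ α) z (e.trans (Category.assoc _ _ _).symm)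
        exact (ih _).1 (h G f y hy)
      · exact (ih _).2 (h G f _ (by rw [tail_lift, e, Category.assoc]))
  | ex Φ ih =>
      refine forces_ex.trans (Iff.trans ⟨?_, ?_⟩ forces_ex.symm)
      · rintro ⟨G, f, z, hf, e, h⟩
        exact ⟨G, f, _, hf, by rw [tail_lift, e, Category.assoc], (ih _).1 h⟩
      · rintro ⟨G, f, z, hf, e, h⟩
        obtain ⟨y, hy, rfl⟩ := exists_lift σ (f ≫ α) z (e.trans (Category.assoc _ _ _).symm)
        exact ⟨G, f, y, hf, hy, (ih _).2 h⟩

/-! ### Standard quantifiers and constant germs. -/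

theorem comp_cons_head (α : F ⟶ simple (L.Env Γ)) (x : L.El S) :
    (α ≫ simpleMap (Env.cons x)) ≫ simpleMap Env.head = const F x := by
  rw [Category.assoc, simpleMap_comp]
  exact comp_simpleMap_const α x

theorem comp_cons_tail (α : F ⟶ simple (L.Env Γ)) (x : L.El S) :
    (α ≫ simpleMap (Env.cons x)) ≫ simpleMap Env.tail = α := by
  rw [Category.assoc, simpleMap_comp]
  exact Category.comp_id α

theorem eq_comp_cons {α : F ⟶ simple (L.Env Γ)} {x : L.El S} {z : F ⟶ simple (L.Env (S :: Γ))}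
    (h : z ≫ simpleMap Env.head = const F x) (h' : z ≫ simpleMap Env.tail = α) :
    z = α ≫ simpleMap (Env.cons x) :=
  env_germ_ext (h.trans (comp_cons_head α x).symm) (h'.trans (comp_cons_tail α x).symm)

/-- A standard element at a later stage is the pullback of a constant at `F`, so monotonicity of
forcing reduces everything to constants at `F`. -/
theorem forces_allSt {Φ : Fml (S :: Γ)} {α : F ⟶ simple (L.Env Γ)} :
    Forces F (Fml.allSt Φ) α ↔ ∀ x : L.El S, Forces F Φ (α ≫ simpleMap (Env.cons x)) := by
  constructor
  · intro h x
    exact (forces_all.1 h F (𝟙 F) (α ≫ simpleMap (Env.cons x))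
      ((comp_cons_tail α x).trans (Category.id_comp α).symm)).mp ⟨x, comp_cons_head α x⟩
  · intro h
    refine forces_all.2 fun G f z e => forces_imp.2 fun H g ⟨x, hx⟩ => ?_
    rw [eq_comp_cons (α := (g ≫ f) ≫ α) hx (by rw [Category.assoc, e, Category.assoc]),
      Category.assoc]
    exact forces_mono (h x) _

/-- The witness on the cover is one constant `x`, since the cover is a single filter; forcing at `x`
then descends to `F`. This holds for every formula, which is why `NU` and `AC` need no restriction
on `Φ`. -/
theorem forces_exSt {Φ : Fml (S :: Γ)} {α : F ⟶ simple (L.Env Γ)} :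
    Forces F (Fml.exSt Φ) α ↔ ∃ x : L.El S, Forces F Φ (α ≫ simpleMap (Env.cons x)) := by
  constructor
  · intro h
    obtain ⟨G, f, z, hf, e, ⟨x, hx⟩, h⟩ := forces_ex.1 h
    refine ⟨x, .of_covering hf ?_⟩
    rw [← Category.assoc, ← eq_comp_cons hx e]
    exact h
  · rintro ⟨x, h⟩
    exact forces_ex.2 ⟨F, 𝟙 F, _, covering_id F,
      (comp_cons_tail α x).trans (Category.id_comp α).symm, ⟨x, comp_cons_head α x⟩, h⟩

theorem forces_hyper {α : F ⟶ simple (L.Env (L.seq S :: Γ))} :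
    Forces F (Fml.hyper (S := S) (.var .zero)) α ↔
      ∀ x : L.El S, Within α {ρ | x ∈ L.seqEquiv S ρ.head} :=
  forces_allSt.trans <| forall_congr' fun _ => forces_mem.trans within_comp_simpleMap

/-! ### Truth of internal `∨`-free formulas -/

/-- The subset of `S₁ × ⋯ × Sₙ` denoted by an internal formula in `Set` (`st` is read as truth). -/
def Fml.truth : ∀ {Γ : List L.Ty}, Fml Γ → Set (L.Env Γ)
  | _, .falsum => ∅
  | _, .rel R ts => {ρ | tuple (fun T x => (ts T x).eval ρ) ∈ L.relEl R}
  | _, .eq s t => {ρ | s.eval ρ = t.eval ρ}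
  | _, .mem (S := S) t s => {ρ | t.eval ρ ∈ L.seqEquiv S (s.eval ρ)}
  | _, .st _ => Set.univ
  | _, .and Φ Ψ => Φ.truth ∩ Ψ.truth
  | _, .or Φ Ψ => Φ.truth ∪ Ψ.truth
  | _, .imp Φ Ψ => {ρ | ρ ∈ Φ.truth → ρ ∈ Ψ.truth}
  | _, .all Φ => {ρ | ∀ x, Env.cons x ρ ∈ Φ.truth}
  | _, .ex Φ => {ρ | ∃ x, Env.cons x ρ ∈ Φ.truth}

/-- An internal `∨`-free formula is forced at a filter iff it is true on a base set. -/
theorem forces_iff_within_truth {φ : Fml Γ} (hi : φ.Internal) (ho : φ.OrFree)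
    {α : F ⟶ simple (L.Env Γ)} : Forces F φ α ↔ Within α φ.truth := by
  induction φ generalizing F with
  | falsum => exact Iff.rfl
  | rel R ts => exact forces_rel
  | eq s t => exact forces_eq
  | mem t s => exact forces_mem
  | st t => exact hi.elim
  | and Φ Ψ h h' => exact (and_congr (h hi.1 ho.1) (h' hi.2 ho.2)).trans within_inter.symm
  | or Φ Ψ => exact ho.elim
  | imp Φ Ψ h h' =>
      refine forces_imp.trans ?_
      simp only [h hi.1 ho.1, h' hi.2 ho.2]
      constructor
      · intro H
        -- With trivial `C` the classifying filter is the restriction of `F` to the points where `Φ`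
        -- is true, the most general stage forcing the premise.
        obtain ⟨G, π, z, e, hz, -, -⟩ := exists_classifying α (C := PUnit) (J := PUnit)
          (fun _ => Prod.snd ⁻¹' Φ.truth) fun _ _ => ⟨⟨⟩, fun _ h => ⟨h, h⟩⟩
        have := H G π
        rw [← e, within_comp_simpleMap, within_comp_simpleMap, hz, hz] at this
        obtain ⟨-, h⟩ := this ⟨⟨⟩, (within_univ α).mono fun _ _ _ h => h⟩
        exact h.mono fun _ hx => hx ⟨⟩
      · intro H G f hG
        exact (within_inter.2 ⟨H.comp f, hG⟩).mono fun _ hx => hx.1 hx.2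
  | all Φ ih =>
      refine forces_all.trans ?_
      simp only [ih hi ho]
      constructor
      · intro H
        -- The generic element of the quantified type: truth at it is truth for all values, over a
        -- base set of `F`.
        obtain ⟨G, π, z, e, hz, -, -⟩ := exists_classifying_var α (J := PUnit)
          (fun _ => Set.univ) fun _ _ => ⟨⟨⟩, fun _ h => ⟨h, h⟩⟩
        obtain ⟨-, h⟩ := (hz _).1 (H G π z e)
        exact h.mono fun _ hx c => hx c trivial
      · intro H G f z e
        have := H.comp f
        rw [← e, within_comp_simpleMap] at this
        exact this.mono fun ρ hρ => hρ ρ.head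
  | ex Φ ih =>
      refine forces_ex.trans ?_
      simp only [ih hi ho]
      constructor
      · rintro ⟨G, f, z, hf, e, h⟩
        refine isClosed_ySub _ f hf α ?_
        change Within (f ≫ α) _
        rw [← e, within_comp_simpleMap]
        exact h.mono fun ρ hρ => ⟨ρ.head, hρ⟩
      · intro H
        -- All witnesses are adjoined at once; the projection covers because a witness exists over
        -- each point of a base set.
        obtain ⟨G, π, z, e, hz, hc, -⟩ := exists_classifying_var α (J := PUnit)
          (fun _ => Φ.truth) fun _ _ => ⟨⟨⟩, fun _ h => ⟨h, h⟩⟩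
        exact ⟨G, π, z, hc fun _ => H, e,
          (hz _).2 ⟨⟨⟩, (within_univ α).mono fun _ _ _ h => h⟩⟩

/-! ### The principles -/

theorem holds_OS {φ : Fml (L.seq S :: Γ)} (hi : φ.Internal) (ho : φ.OrFree) :
    Holds (Fml.OS φ) := by
  intro F α
  refine forces_imp.2 fun G f h => forces_ex.2 ?_
  rw [forces_allSt] at h
  simp only [forces_iff_within_truth hi ho, within_comp_simpleMap] at h
  have : Nonempty (L.El (L.seq S)) := ⟨(L.seqEquiv S).symm []⟩
  -- The generic sequence satisfying `φ` and containing every standard element; concatenation of the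
  -- indices makes the family directed.
  obtain ⟨H, π, z, e, hz, hc, -⟩ := exists_classifying_var (f ≫ α) (J := L.El (L.seq S))
    (fun t => {ρ | ρ ∈ φ.truth ∧ ∀ x ∈ L.seqEquiv S t, x ∈ L.seqEquiv S ρ.head})
    fun s t => ⟨(L.seqEquiv S).symm (L.seqEquiv S s ++ L.seqEquiv S t), fun ρ hρ => by
      simp only [Equiv.apply_symm_apply, List.mem_append] at hρ
      exact ⟨⟨hρ.1, fun x hx => hρ.2 x (.inl hx)⟩, hρ.1, fun x hx => hρ.2 x (.inr hx)⟩⟩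
  -- The base set of index `t` has inhabited fibres because `t` contains its own entries and
  -- satisfies `φ` by the premise.
  refine ⟨H, π, z, hc fun t => (h t).mono fun ρ hρ => ⟨t, hρ, fun _ hx => hx⟩, e,
    forces_hyper.2 fun x => ?_, (forces_iff_within_truth hi ho).2 ?_⟩
  · exact (hz _).2 ⟨(L.seqEquiv S).symm [x], (within_univ _).mono fun _ _ _ h => h.2 x (by simp)⟩
  · exact (hz _).2 ⟨Classical.arbitrary _, (within_univ _).mono fun _ _ _ h => h.1⟩

theorem holds_US {φ : Fml (L.seq S :: Γ)} (hi : φ.Internal) (ho : φ.OrFree) :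
    Holds (Fml.US φ) := by
  intro F α
  refine forces_imp.2 fun G f h => forces_exSt.2 ?_
  have : Nonempty (L.El (L.seq S)) := ⟨(L.seqEquiv S).symm []⟩
  -- The generic hyper sequence. The premise is universal, so it can be applied at `H` without `π`
  -- being a cover.
  obtain ⟨H, π, z, e, hz, -, -⟩ := exists_classifying_var (f ≫ α) (J := L.El (L.seq S))
    (fun t => {ρ | ∀ x ∈ L.seqEquiv S t, x ∈ L.seqEquiv S ρ.head})
    fun s t => ⟨(L.seqEquiv S).symm (L.seqEquiv S s ++ L.seqEquiv S t), fun ρ hρ => by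
      simp only [Equiv.apply_symm_apply, List.mem_append] at hρ
      exact ⟨fun x hx => hρ x (.inl hx), fun x hx => hρ x (.inr hx)⟩⟩
  have hyp : Forces H (Fml.hyper (S := S) (.var .zero)) z := forces_hyper.2 fun x =>
    (hz _).2 ⟨(L.seqEquiv S).symm [x], (within_univ _).mono fun _ _ _ h => h x (by simp)⟩
  -- Near `f ≫ α`, every sequence containing the entries of `t` satisfies `φ`; `t` is one of them.
  obtain ⟨t, ht⟩ := (hz _).1 ((forces_iff_within_truth hi ho).1 ((forces_all.1 h H π z e).mp hyp))
  exact ⟨t, (forces_iff_within_truth hi ho).2 <| within_comp_simpleMap.2 <|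
    ht.mono fun ρ hρ => hρ t fun _ hx => hx⟩

theorem env_insertVar (Γ : List L.Ty) (S T : L.Ty) (x : L.El S) (t : L.El T) (ρ : L.Env Γ) :
    (Fml.insertVar Γ S T).env (Env.cons x (Env.cons t ρ)) = Env.cons x ρ :=
  congrArg (Env.cons x) (tuple_eval ρ)

theorem env_swapVar (Γ : List L.Ty) (S T : L.Ty) (x : L.El S) (t : L.El T) (ρ : L.Env Γ) :
    (Fml.swapVar Γ S T).env (Env.cons t (Env.cons x ρ)) = Env.cons x (Env.cons t ρ) :=
  congrArg (fun ρ => Env.cons x (Env.cons t ρ)) (tuple_eval ρ)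

theorem env_applySubst (Γ : List L.Ty) {S T : L.Ty} (P : L.FunctionType S T) (x : L.El S)
    (f : L.El P.ty) (ρ : L.Env Γ) :
    (Fml.applySubst Γ P).env (Env.cons x (Env.cons f ρ)) =
      Env.cons (P.equiv f x) (Env.cons x ρ) :=
  congrArg₂ (fun t ρ => Env.cons t (Env.cons x ρ)) (P.app_eq f x) (tuple_eval ρ)

theorem holds_IP {φ : Fml (S :: Γ)} (Ψ : Fml (T :: Γ)) (hi : φ.Internal) (ho : φ.OrFree) :
    Holds (Fml.IP φ Ψ) := by
  intro F α
  refine forces_imp.2 fun G f h => forces_exSt.2 ?_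
  -- The universal stage over `G` that forces `∀ˢᵗ x, φ(x)`. Finite lists of instances are used as
  -- indices so that the conditions form a filter base.
  obtain ⟨H, π, z, e, hz, -, hu⟩ := exists_classifying (f ≫ α) (C := PUnit)
    (J := List (L.El S)) (fun l => {ρ | ∀ x ∈ l, Env.cons x ρ.2 ∈ φ.truth})
    fun s t => ⟨s ++ t, fun ρ hρ => ⟨fun x hx => hρ x (List.mem_append_left _ hx),
      fun x hx => hρ x (List.mem_append_right _ hx)⟩⟩
  have hφ : Forces H (Fml.allSt φ) (π ≫ f ≫ α) := forces_allSt.2 fun x => by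
    rw [forces_iff_within_truth hi ho, within_comp_simpleMap, ← e, within_comp_simpleMap]
    exact (hz _).2 ⟨[x], (within_univ _).mono fun _ _ _ h => h x (by simp)⟩
  obtain ⟨t, ht⟩ := forces_exSt.1 (forces_imp.1 h H π hφ)
  refine ⟨t, forces_imp.2 fun K g hg => ?_⟩
  -- A stage `K` forcing the premise meets each finite list of conditions, so it factors through
  -- `H`, where `Ψ` is already forced at `t`.
  have hg' : ∀ l : List (L.El S), Within (g ≫ f ≫ α) {ρ | ∀ x ∈ l, Env.cons x ρ ∈ φ.truth} := by
    intro l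
    induction l with
    | nil => exact (within_univ _).mono fun _ _ => by simp
    | cons x l ih =>
        have hx := forces_allSt.1 hg x
        rw [forces_subst, ← Category.assoc, germ_comp_simpleMap_comp, germ_comp_simpleMap_comp,
          forces_iff_within_truth hi ho, within_comp_simpleMap] at hx
        refine (within_inter.2 ⟨hx, ih⟩).mono fun ρ hρ => List.forall_mem_cons.2 ⟨?_, hρ.2⟩
        rw [← env_insertVar Γ S T x t ρ]
        exact hρ.1
  obtain ⟨k, hk, -⟩ := hu K g ((g ≫ f ≫ α) ≫ simpleMap fun ρ => (⟨⟩, ρ))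
    ((germ_comp_simpleMap_comp _ _ _).trans (Category.comp_id _))
    fun l => within_comp_simpleMap.2 (hg' l)
  rw [← hk, Category.assoc k π, ← Category.assoc π]
  exact forces_mono ht k

theorem holds_NU (Φ : Fml (S :: T :: Γ)) : Holds (Fml.NU Φ) := by
  intro F α
  refine forces_imp.2 fun G f h => forces_exSt.2 ?_
  -- The generic element of `T` over `G`; the standard `x` found for it serves uniformly.
  obtain ⟨H, π, z, e, -, -, hu⟩ := exists_classifying_var (S := T) (f ≫ α) (J := PUnit)
    (fun _ => Set.univ) fun _ _ => ⟨⟨⟩, fun _ h => ⟨h, h⟩⟩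
  obtain ⟨x, hx⟩ := forces_exSt.1 (forces_all.1 h H π z e)
  refine ⟨x, forces_all.2 fun K g y hy => (forces_subst _).2 ?_⟩
  -- Dropping the constant `x` from the context leaves an arbitrary element of `T`, hence a pullback
  -- of the generic one.
  obtain ⟨k, -, hk⟩ := hu K g (y ≫ simpleMap fun ρ => Env.cons ρ.head ρ.tail.tail)
    (by
      rw [germ_comp_simpleMap_comp]
      change y ≫ simpleMap (Env.tail ∘ Env.tail) = _
      rw [← germ_comp_simpleMap_comp, hy, Category.assoc, comp_cons_tail])
    fun _ => within_univ _
  have hy' : y ≫ simpleMap (Fml.swapVar Γ S T).env = k ≫ z ≫ simpleMap (Env.cons x) := by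
    rw [← Category.assoc, hk]
    have he : (Fml.swapVar Γ S T).env =
        fun ρ => Env.cons ρ.tail.head (Env.cons ρ.head ρ.tail.tail) :=
      funext fun ρ => env_swapVar Γ S T ρ.tail.head ρ.head ρ.tail.tail
    rw [he]
    refine eq_comp_cons ?_ (germ_comp_simpleMap_comp _ _ _)
    rw [germ_comp_simpleMap_comp]
    change y ≫ simpleMap (Env.head ∘ Env.tail) = _
    rw [← germ_comp_simpleMap_comp, hy, Category.assoc, comp_cons_head, comp_const]
  rw [hy']
  exact forces_mono hx k

theorem holds_AC (P : L.FunctionType S T) (Φ : Fml (T :: S :: Γ)) : Holds (Fml.AC P Φ) := by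
  intro F α
  refine forces_imp.2 fun G f h => forces_exSt.2 ?_
  -- The witnesses are elements of the set denoted by `T`, not germs, so choice yields an actual
  -- function, which is a standard element of the function type.
  choose c hc using fun x => forces_exSt.1 (forces_allSt.1 h x)
  refine ⟨P.equiv.symm c, forces_allSt.2 fun x => (forces_subst _).2 ?_⟩
  rw [germ_comp_simpleMap_comp, germ_comp_simpleMap_comp]
  convert hc x using 1
  rw [germ_comp_simpleMap_comp]
  congr 2
  funext ρ
  refine (env_applySubst Γ P x (P.equiv.symm c) ρ).trans ?_
  rw [Equiv.apply_symm_apply]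
  rfl

end SetLanguage

open SetLanguage in
theorem mainTheorem9 (L : SetLanguage.{u, v, w}) :
    (∀ (Γ : List L.Ty) (S : L.Ty) (φ : Fml (L.seq S :: Γ)),
      φ.Internal → φ.OrFree → Holds (Fml.OS φ)) ∧
    (∀ (Γ : List L.Ty) (S : L.Ty) (φ : Fml (L.seq S :: Γ)),
      φ.Internal → φ.OrFree → Holds (Fml.US φ)) ∧
    (∀ (Γ : List L.Ty) (S T : L.Ty) (φ : Fml (S :: Γ)) (Ψ : Fml (T :: Γ)),
      φ.Internal → φ.OrFree → Holds (Fml.IP φ Ψ)) ∧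
    (∀ (Γ : List L.Ty) (S T : L.Ty) (Φ : Fml (S :: T :: Γ)), Holds (Fml.NU Φ)) ∧
    (∀ (Γ : List L.Ty) (S T : L.Ty) (P : L.FunctionType S T) (Φ : Fml (T :: S :: Γ)),
      Holds (Fml.AC P Φ)) :=
  ⟨fun _ _ _ => holds_OS, fun _ _ _ => holds_US, fun _ _ _ _ Ψ hi ho => holds_IP Ψ hi ho,
    fun _ _ _ => holds_NU, fun _ _ _ => holds_AC⟩
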